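/- Let $n\ge 5$ be odd and $a,b\in\mathbb C$. Let $\mathcal{GN}(a,b)$ be the complex vector space with basis $c$; $x_i^p$ ($1\le p\le n$, $1\le i\le p+1$); $y_i^p$ ($1\le p\le n$, $p\neq 2$, $1\le i\le p+1$), where we write $x_i=x_i^1$, $y_i=y_i^1$, $z_i=x_i^2$, and with the skew-symmetric product whose only non-zero products of basis vectors (up to skew-symmetry) are $$[x_1,x_2]=[y_1,y_2]=c,\qquad [x_j,y_i]=z_{i+j-1}\quad(i,j\in\{1,2\}),$$ $$[x_j,x_i^{q}]=x_{i+j-1}^{q+1}\ (2\le q\le n-1),\quad [y_j,z_i]=y^3_{i+j-1},\quad [y_j,y_i^{q}]=y_{i+j-1}^{q+1}\ (3\le q\le n-2),\quad [y_j,x_i^{n-1}]=y^n_{i+j-1},$$ $$[x_j^p,x_i^{n-p}]=(-1)^{p-1}y^n_{i+j-1}\quad (2\le p\le \tfrac{n-1}{2}),$$ $$[x_j,y_i^n]=a\,(i-1-(j-1)n)\,y^{n-1}_{i+j-2},\qquad [y_j,x_i^n]=-b\,(i-1-(j-1)n)\,y^{n-1}_{i+j-2},$$ $$[x_j^p,x_i^{n-p+1}]=\tfrac{(p-1)a+b}{p}\,(-1)^p\big((i-1)p-(j-1)(n-p+1)\big)\,y^{n-1}_{i+j-2}\quad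 (2\le p\le\tfrac{n+1}{2}),$$ (the lower indices run over all admissible values, and a vector whose lower index is out of range is $0$). The algebra $\mathfrak{sl}_2=\langle e,h,f\rangle$, $[h,e]=2e$, $[h,f]=-2f$, $[e,f]=h$, acts by $h\cdot v_i^p=(p+2-2i)v_i^p$, $e\cdot v_i^p=(i-1)v_{i-1}^p$, $f\cdot v_i^p=(p+1-i)v_{i+1}^p$ for $v\in\{x,y\}$, and $\mathfrak{sl}_2\cdot c=0$. For $k\ge 1$, $a_i,b_i\in\mathbb C$ and signs $*\in\{\rtimes,\ltimes\}$ (chosen independently), put $$\mathfrak{sl}_2\mathcal G(a_i,b_i)=\mathfrak{sl}_2\ltimes\big(\mathcal{GN}(a_1,b_1)*(\mathcal{GN}(a_2,b_2)*(\cdots*\mathcal{GN}(a_k,b_k)))\big).$$ Here in $A\rtimes B$ the factor $A$ is an ideal on which $B$ acts, and in $A\ltimes B$ the factor $B$ is an ideal on which $A$ acts; an element of one copy acts on another copy as the bracket with the element having the same coordinates there. Thus, with superscripts $(s)$ for the copies, and $*_s$ for the sign to the right of the $s$-th copy, for $s<t$ the bracket $[g^{(s)},h^{(t)}]$ is the product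 of $g$ and $h$ computed in the $s$-th copy if $*_s=\rtimes$, and in the $t$-th copy if $*_s=\ltimes$. This skew-symmetric algebra satisfies the Jacobi identity if and only if $a_i=b_i$ for all $i$. **Theorem.** Let $\mathcal L$ be a Lie algebra in the family $\mathfrak{sl}_2\mathcal G(a_i,b_i)$, that is, let $a_i=b_i$ for $1\le i\le k$. Let $\Psi:\mathcal L\wedge\mathcal L\to\mathcal L$ be the skew-symmetric bilinear map with $$\Psi(x_1^{(1)},y_2^{(1)})=c^{(1)},\qquad \Psi(x_2^{(1)},y_1^{(1)})=-c^{(1)},$$ and, up to skew-symmetry, $\Psi(u,v)=0$ for all other pairs of basis vectors $u,v$. Then $\Psi$ is an $\mathfrak{sl}_2$-invariant $2$-cocycle of $\mathcal L$ with values in the adjoint module, and it is not a coboundary. In particular $$\dim H^2(\mathcal L,\mathcal L)\ge 1 .$$ Moreover $\mathcal L$ is not rigid: it has a formal deformation $[\,,]+\sum_{m\ge1}t^m\mu_m$ (a $\mathbb C[[t]]$-bilinear Lie bracket on $\mathcal L[[t]]$ that reduces to the bracket of $\mathcal L$ modulo $t$) which is not equivalent to the constant deformation under any $\mathbb C[[t]]$-linear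 isomorphism of the form $\mathrm{id}+\sum_{m\ge 1}t^m\varphi_m$. -/

import Mathlib

namespace Sato

/-- Labels of the basis vectors of `GN(a,b)`: the vector `c`, the vectors `x p i`
(so `x 1 i` is the generator `x_i`, and `x 2 i` is `z_i`), and the vectors `y p i`
(`y 1 i` is the generator `y_i`). The indices `i` start at `1`. -/
inductive Gen where
  | c : Gen
  | x : ℕ → ℕ → Gen
  | y : ℕ → ℕ → Gen

/-- The labels that occur for a given `n`. -/
def Gen.Valid (n : ℕ) : Gen → Prop
  | .c => True
  | .x p i => 1 ≤ p ∧ p ≤ n ∧ 1 ≤ i ∧ i ≤ p + 1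
  | .y p i => 1 ≤ p ∧ p ≤ n ∧ p ≠ 2 ∧ 1 ≤ i ∧ i ≤ p + 1

/-- The vector space of `GN(a,b)`, with basis the valid labels. -/
abbrev GN (n : ℕ) : Type := {g : Gen // g.Valid n} →₀ ℂ

open Classical in
/-- The basis vector with a given label; it is `0` if the label does not occur. -/
noncomputable def vec (n : ℕ) (g : Gen) : GN n :=
  if h : g.Valid n then Finsupp.single ⟨g, h⟩ 1 else 0

/-- The listed products of `GN(a,b)`, each one in one order only. -/
noncomputable def half (n : ℕ) (a b : ℂ) : Gen → Gen → GN n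
  | .x p j, .x q i =>
      if p = 1 ∧ q = 1 then
        (if j = 1 ∧ i = 2 then vec n .c else 0)
      else if p = 1 ∧ 2 ≤ q ∧ q + 1 ≤ n then
        vec n (.x (q + 1) (i + j - 1))
      else if 2 ≤ p ∧ p < q ∧ p + q = n then
        (-1 : ℂ) ^ (p - 1) • vec n (.y n (i + j - 1))
      else if 2 ≤ p ∧ (p < q ∨ (p = q ∧ j < i)) ∧ p + q = n + 1 then
        ((((p : ℂ) - 1) * a + b) / p *
          ((-1 : ℂ) ^ p * (((i : ℂ) - 1) * p - ((j : ℂ) - 1) * ((n : ℂ) - p + 1)))) •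
            vec n (.y (n - 1) (i + j - 2))
      else 0
  | .x p j, .y q i =>
      if p = 1 ∧ q = 1 then
        vec n (.x 2 (i + j - 1))
      else if p = 1 ∧ q = n then
        (a * ((i : ℂ) - 1 - ((j : ℂ) - 1) * n)) • vec n (.y (n - 1) (i + j - 2))
      else 0
  | .y p j, .x q i =>
      if p = 1 ∧ q = 2 then
        vec n (.y 3 (i + j - 1))
      else if p = 1 ∧ q + 1 = n then
        vec n (.y n (i + j - 1))
      else if p = 1 ∧ q = n then
        (-b * ((i : ℂ) - 1 - ((j : ℂ) - 1) * n)) • vec n (.y (n - 1) (i + j - 2))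
      else 0
  | .y p j, .y q i =>
      if p = 1 ∧ q = 1 then
        (if j = 1 ∧ i = 2 then vec n .c else 0)
      else if p = 1 ∧ 3 ≤ q ∧ q + 2 ≤ n then
        vec n (.y (q + 1) (i + j - 1))
      else 0
  | _, _ => 0

/-- The multiplication table of `GN(a,b)` on basis vectors. -/
noncomputable def table (n : ℕ) (a b : ℂ) (g g' : Gen) : GN n :=
  half n a b g g' - half n a b g' g

/-- The standard basis of `sl₂`. -/
inductive Sl where
  | e : Sl
  | h : Sl
  | f : Sl

/-- The action of `sl₂` on the basis vectors of `GN(a,b)`. -/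
noncomputable def act (n : ℕ) : Sl → Gen → GN n
  | _, .c => 0
  | .h, .x p i => ((p : ℂ) + 2 - 2 * i) • vec n (.x p i)
  | .e, .x p i => ((i : ℂ) - 1) • vec n (.x p (i - 1))
  | .f, .x p i => ((p : ℂ) + 1 - i) • vec n (.x p (i + 1))
  | .h, .y p i => ((p : ℂ) + 2 - 2 * i) • vec n (.y p i)
  | .e, .y p i => ((i : ℂ) - 1) • vec n (.y p (i - 1))
  | .f, .y p i => ((p : ℂ) + 1 - i) • vec n (.y p (i + 1))

/-- The bilinear map with prescribed values on a basis. -/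
noncomputable def bilin {I V : Type*} [AddCommGroup V] [Module ℂ V] (t : I → I → V) :
    (I →₀ ℂ) →ₗ[ℂ] (I →₀ ℂ) →ₗ[ℂ] V :=
  Finsupp.linearCombination ℂ fun i => Finsupp.linearCombination ℂ (t i)

theorem bilin_single {I V : Type*} [AddCommGroup V] [Module ℂ V] (t : I → I → V) (i j : I) :
    bilin t (Finsupp.single i 1) (Finsupp.single j 1) = t i j := by
  simp [bilin]

/-- The bracket of `GN(a,b)`. -/
noncomputable def nbr (n : ℕ) (a b : ℂ) : GN n →ₗ[ℂ] GN n →ₗ[ℂ] GN n :=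
  bilin fun g g' => table n a b g.1 g'.1

/-- The action of a basis vector of `sl₂` on `GN(a,b)`. -/
noncomputable def nact (n : ℕ) (s : Sl) : GN n →ₗ[ℂ] GN n :=
  Finsupp.linearCombination ℂ fun g => act n s g.1

/-! A polynomial model, used to verify the Jacobi identity: `x p i` corresponds to the
monomial `X ^ (p + 1 - i) * Y ^ (i - 1)` in degree `p`. -/

/-- Polynomials in two variables. -/
abbrev Pol : Type := MvPolynomial (Fin 2) ℂ

/-- The Poisson bracket. -/
noncomputable def pb (u v : Pol) : Pol :=
  MvPolynomial.pderiv 0 u * MvPolynomial.pderiv 1 v -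
    MvPolynomial.pderiv 1 u * MvPolynomial.pderiv 0 v

theorem pb_mul (u v w : Pol) : pb u (v * w) = pb u v * w + v * pb u w := by
  simp [pb, Derivation.leibniz]; ring

theorem pb_add (u v w : Pol) : pb u (v + w) = pb u v + pb u w := by
  simp [pb]; ring

theorem pb_sub (u v w : Pol) : pb u (v - w) = pb u v - pb u w := by
  simp [pb]; ring

theorem pb_smul (r : ℂ) (u v : Pol) : pb u (r • v) = r • pb u v := by
  simp [pb, smul_sub]

theorem pb_smul_left (r : ℂ) (u v : Pol) : pb (r • u) v = r • pb u v := by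
  simp [pb, smul_sub]

theorem pb_zero (u : Pol) : pb u 0 = 0 := by simp [pb]

theorem pb_zero_left (u : Pol) : pb 0 u = 0 := by simp [pb]

theorem pb_skew (u v : Pol) : pb u v = - pb v u := by
  simp [pb]; ring

theorem pb_add_left (u v w : Pol) : pb (u + v) w = pb u w + pb v w := by
  simp [pb]; ring

theorem pb_sum {ι : Type*} (s : Finset ι) (u : Pol) (f : ι → Pol) :
    pb u (∑ i ∈ s, f i) = ∑ i ∈ s, pb u (f i) := by
  simp [pb, Finset.mul_sum, Finset.sum_sub_distrib]

theorem pb_jac (u v w : Pol) : pb u (pb v w) = pb (pb u v) w + pb v (pb u w) := by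
  have h (t : Pol) : MvPolynomial.pderiv 0 (MvPolynomial.pderiv 1 t) =
      MvPolynomial.pderiv (R := ℂ) (σ := Fin 2) 1 (MvPolynomial.pderiv 0 t) := by
    have key : ⁅(MvPolynomial.pderiv 0 : Derivation ℂ Pol Pol),
        (MvPolynomial.pderiv 1 : Derivation ℂ Pol Pol)⁆ = 0 := by
      apply MvPolynomial.derivation_ext
      intro i
      fin_cases i <;> simp [Derivation.commutator_apply, MvPolynomial.pderiv_X]
    have := congrArg (fun D : Derivation ℂ Pol Pol => D t) key
    simpa [Derivation.commutator_apply, sub_eq_zero] using this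
  simp [pb, Derivation.leibniz, h]; ring

/-- Triples: the `x`-components, the `y`-components, and the `c`-component. -/
abbrev Mdl : Type := (ℕ → Pol) × (ℕ → Pol) × Pol

/-- Part of the bracket of the model. -/
noncomputable def s0 (n : ℕ) (u v : ℕ → Pol) : Pol :=
  ∑ r ∈ Finset.HasAntidiagonal.antidiagonal (n - 4), (-1 : ℂ) ^ (r.1 + 1) • (u (r.1 + 2) * v (r.2 + 2))

/-- Part of the bracket of the model. -/
noncomputable def s1 (n : ℕ) (u v : ℕ → Pol) : Pol :=
  ∑ r ∈ Finset.HasAntidiagonal.antidiagonal (n - 3), (-1 : ℂ) ^ r.1 • pb (u (r.1 + 2)) (v (r.2 + 2))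

/-- The `x`-components of the bracket of the model. -/
noncomputable def mx (n : ℕ) (F G : Mdl) (k : ℕ) : Pol :=
  if k = 2 then F.1 1 * G.2.1 1 - F.2.1 1 * G.1 1
  else if 3 ≤ k ∧ k ≤ n then F.1 1 * G.1 (k - 1) - F.1 (k - 1) * G.1 1
  else 0

/-- The `y`-components of the bracket of the model. -/
noncomputable def my (n : ℕ) (a : ℂ) (F G : Mdl) (k : ℕ) : Pol :=
  if k = 3 then F.2.1 1 * G.1 2 - F.1 2 * G.2.1 1
  else if k = n then F.2.1 1 * G.1 (n - 1) - F.1 (n - 1) * G.2.1 1 + s0 n F.1 G.1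
  else (if 4 ≤ k ∧ k + 1 ≤ n then F.2.1 1 * G.2.1 (k - 1) - F.2.1 (k - 1) * G.2.1 1 else 0) +
    (if k + 1 = n then a • (pb (F.1 1) (G.2.1 n) + pb (F.2.1 n) (G.1 1) -
      pb (F.2.1 1) (G.1 n) - pb (F.1 n) (G.2.1 1) + s1 n F.1 G.1) else 0)

/-- The bracket of the model. -/
noncomputable def mbr (n : ℕ) (a : ℂ) (F G : Mdl) : Mdl :=
  (mx n F G, my n a F G, pb (F.1 1) (G.1 1) + pb (F.2.1 1) (G.2.1 1))

/-- The action of a polynomial on the model. -/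
noncomputable def mact (u : Pol) (F : Mdl) : Mdl :=
  (fun k => pb u (F.1 k), fun k => pb u (F.2.1 k), pb u F.2.2)

theorem mact_mbr (n : ℕ) (a : ℂ) (u : Pol) (F G : Mdl) :
    mact u (mbr n a F G) = mbr n a (mact u F) G + mbr n a F (mact u G) := by
  refine Prod.ext ?_ (Prod.ext ?_ ?_)
  · funext k
    simp only [mact, mbr, mx, Prod.fst_add, Pi.add_apply]
    split_ifs
    · rw [pb_sub, pb_mul, pb_mul]; ring
    · rw [pb_sub, pb_mul, pb_mul]; ring
    · simp [pb_zero]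
  · funext k
    have h0 : pb u (s0 n F.1 G.1) =
        s0 n (fun k => pb u (F.1 k)) G.1 + s0 n F.1 (fun k => pb u (G.1 k)) := by
      simp only [s0, pb_sum, pb_smul, pb_mul, smul_add, Finset.sum_add_distrib]
    have h1 : pb u (s1 n F.1 G.1) =
        s1 n (fun k => pb u (F.1 k)) G.1 + s1 n F.1 (fun k => pb u (G.1 k)) := by
      simp only [s1, pb_sum, pb_smul, pb_jac u, smul_add, Finset.sum_add_distrib]
    simp only [mact, mbr, my, Prod.snd_add, Prod.fst_add, Pi.add_apply]
    split_ifs <;> simp only [pb_add, pb_sub, pb_smul, pb_mul, h0, h1, pb_jac u, smul_add, smul_sub,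
      pb_zero] <;> ring
  · simp only [mact, mbr, Prod.snd_add]
    rw [pb_add, pb_jac u, pb_jac u]; ring

theorem mact_comm (u v : Pol) (F : Mdl) :
    mact (pb u v) F = mact u (mact v F) - mact v (mact u F) := by
  refine Prod.ext ?_ (Prod.ext ?_ ?_)
  · funext k; simp only [mact, Prod.fst_sub, Pi.sub_apply]; rw [pb_jac u]; ring
  · funext k; simp only [mact, Prod.fst_sub, Prod.snd_sub, Pi.sub_apply]; rw [pb_jac u]; ring
  · simp only [mact, Prod.snd_sub]; rw [pb_jac u]; ring

theorem s0_symm (m : ℕ) (u v : ℕ → Pol) :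
    ∑ r ∈ Finset.HasAntidiagonal.antidiagonal (2 * m), (-1 : ℂ) ^ (r.1 + 1) • (u (r.1 + 2) * v (r.2 + 2)) =
    ∑ r ∈ Finset.HasAntidiagonal.antidiagonal (2 * m), (-1 : ℂ) ^ (r.1 + 1) • (v (r.1 + 2) * u (r.2 + 2)) := by
  rw [← Finset.Nat.sum_antidiagonal_swap]
  refine Finset.sum_congr rfl fun r hr => ?_
  rw [Finset.HasAntidiagonal.mem_antidiagonal] at hr
  have : (-1 : ℂ) ^ (r.2 + 1) = (-1) ^ (r.1 + 1) := by
    rcases Nat.even_or_odd r.1 with h | h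
    · have h2 : Even r.2 := by
        have : Even (r.1 + r.2) := hr ▸ even_two_mul m
        exact (Nat.even_add.1 this).1 h
      rw [h.add_one.neg_one_pow, h2.add_one.neg_one_pow]
    · have h2 : Odd r.2 := by
        have : Even (r.1 + r.2) := hr ▸ even_two_mul m
        rw [Nat.even_add] at this
        rw [← Nat.not_even_iff_odd] at h ⊢
        tauto
      rw [h.add_one.neg_one_pow, h2.add_one.neg_one_pow]
  simp only [Prod.fst_swap, Prod.snd_swap, this]
  rw [mul_comm]

theorem s1_symm (m : ℕ) (u v w : ℕ → Pol) :
    ∑ r ∈ Finset.HasAntidiagonal.antidiagonal (2 * m + 1),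
      (-1 : ℂ) ^ r.1 • pb (u (r.1 + 2)) (w 1 * v (r.2 + 2)) =
    - ∑ r ∈ Finset.HasAntidiagonal.antidiagonal (2 * m + 1),
      (-1 : ℂ) ^ r.1 • pb (u (r.2 + 2)) (w 1 * v (r.1 + 2)) := by
  rw [← Finset.Nat.sum_antidiagonal_swap, ← Finset.sum_neg_distrib]
  refine Finset.sum_congr rfl fun r hr => ?_
  rw [Finset.HasAntidiagonal.mem_antidiagonal] at hr
  have : (-1 : ℂ) ^ r.2 = - (-1) ^ r.1 := by
    have ho : Odd (r.1 + r.2) := hr ▸ odd_two_mul_add_one m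
    rcases Nat.even_or_odd r.1 with h | h
    · have h2 : Odd r.2 := (Nat.odd_add'.1 ho).2 h
      rw [h.neg_one_pow, h2.neg_one_pow]
    · have h2 : Even r.2 := (Nat.odd_add.1 ho).1 h
      rw [h.neg_one_pow, h2.neg_one_pow]; simp
  simp [this]

theorem mbr_jac (m : ℕ) (a : ℂ) (F G H : Mdl) :
    mbr (2 * m + 5) a F (mbr (2 * m + 5) a G H) + mbr (2 * m + 5) a G (mbr (2 * m + 5) a H F) +
      mbr (2 * m + 5) a H (mbr (2 * m + 5) a F G) = 0 := by
  have x1 (A B : Mdl) : (mbr (2 * m + 5) a A B).1 1 = 0 := by simp [mbr, mx]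
  have y1 (A B : Mdl) : (mbr (2 * m + 5) a A B).2.1 1 = 0 := by simp [mbr, my]
  have x2 (A B : Mdl) : (mbr (2 * m + 5) a A B).1 2 = A.1 1 * B.2.1 1 - A.2.1 1 * B.1 1 := by
    simp [mbr, mx]
  have xk (A B : Mdl) (k : ℕ) (h3 : 3 ≤ k) (hk : k ≤ 2 * m + 5) : (mbr (2 * m + 5) a A B).1 k =
      A.1 1 * B.1 (k - 1) - A.1 (k - 1) * B.1 1 := by
    simp only [mbr, mx]; rw [if_neg (by omega), if_pos ⟨h3, hk⟩]
  have y3 (A B : Mdl) : (mbr (2 * m + 5) a A B).2.1 3 = A.2.1 1 * B.1 2 - A.1 2 * B.2.1 1 := by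
    simp [mbr, my]
  have yk (A B : Mdl) (k : ℕ) (h3 : 4 ≤ k) (hk : k + 1 < 2 * m + 5) :
      (mbr (2 * m + 5) a A B).2.1 k = A.2.1 1 * B.2.1 (k - 1) - A.2.1 (k - 1) * B.2.1 1 := by
    simp only [mbr, my]
    rw [if_neg (by omega), if_neg (by omega), if_pos (by omega), if_neg (by omega), add_zero]
  have yn (A B : Mdl) : (mbr (2 * m + 5) a A B).2.1 (2 * m + 5) =
      A.2.1 1 * B.1 (2 * m + 4) - A.1 (2 * m + 4) * B.2.1 1 + s0 (2 * m + 5) A.1 B.1 := by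
    simp only [mbr, my]
    rw [if_neg (by omega)]; simp
  have yn1 (A B : Mdl) : (mbr (2 * m + 5) a A B).2.1 (2 * m + 4) =
      A.2.1 1 * B.2.1 (2 * m + 3) - A.2.1 (2 * m + 3) * B.2.1 1 +
      a • (pb (A.1 1) (B.2.1 (2 * m + 5)) + pb (A.2.1 (2 * m + 5)) (B.1 1) -
      pb (A.2.1 1) (B.1 (2 * m + 5)) - pb (A.1 (2 * m + 5)) (B.2.1 1)
      + s1 (2 * m + 5) A.1 B.1) := by
    simp only [mbr, my]
    rw [if_neg (by omega), if_neg (by omega), if_pos (by omega)]; simp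
  have e0 (A B C : Mdl) : s0 (2 * m + 5) A.1 (mbr (2 * m + 5) a B C).1 =
      A.1 (2 * m + 3) * (B.1 1 * C.2.1 1 - B.2.1 1 * C.1 1) +
      B.1 1 * (∑ r ∈ Finset.HasAntidiagonal.antidiagonal (2 * m),
        (-1 : ℂ) ^ (r.1 + 1) • (A.1 (r.1 + 2) * C.1 (r.2 + 2))) -
      C.1 1 * (∑ r ∈ Finset.HasAntidiagonal.antidiagonal (2 * m),
        (-1 : ℂ) ^ (r.1 + 1) • (A.1 (r.1 + 2) * B.1 (r.2 + 2))) := by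
    rw [s0, show 2 * m + 5 - 4 = 2 * m + 1 from rfl, Finset.Nat.antidiagonal_succ']
    simp only [Finset.sum_cons, Finset.sum_map, Function.Embedding.prodMap, Prod.map,
      Function.Embedding.coeFn_mk, Function.Embedding.refl_apply, zero_add, x2]
    rw [show (-1 : ℂ) ^ (2 * m + 1 + 1) = 1 by
      rw [pow_succ, pow_succ, pow_mul]; norm_num, one_smul, add_sub_assoc]
    congr 1
    rw [Finset.mul_sum, Finset.mul_sum, ← Finset.sum_sub_distrib]
    refine Finset.sum_congr rfl fun r hr => ?_
    rw [Finset.HasAntidiagonal.mem_antidiagonal] at hr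
    rw [xk _ _ _ (by simp) (by simp; omega)]
    simp only [Nat.succ_eq_add_one, show r.2 + 1 + 2 - 1 = r.2 + 2 from rfl]
    simp only [mul_sub, smul_sub, mul_smul_comm]
    congr 2 <;> ring
  have e1 (A B C : Mdl) : s1 (2 * m + 5) A.1 (mbr (2 * m + 5) a B C).1 =
      pb (A.1 (2 * m + 4)) (B.1 1 * C.2.1 1 - B.2.1 1 * C.1 1) +
      (∑ r ∈ Finset.HasAntidiagonal.antidiagonal (2 * m + 1),
        (-1 : ℂ) ^ r.1 • pb (A.1 (r.1 + 2)) (B.1 1 * C.1 (r.2 + 2))) -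
      (∑ r ∈ Finset.HasAntidiagonal.antidiagonal (2 * m + 1),
        (-1 : ℂ) ^ r.1 • pb (A.1 (r.1 + 2)) (C.1 1 * B.1 (r.2 + 2))) := by
    rw [s1, show 2 * m + 5 - 3 = 2 * m + 1 + 1 from rfl, Finset.Nat.antidiagonal_succ']
    simp only [Finset.sum_cons, Finset.sum_map, Function.Embedding.prodMap, Prod.map,
      Function.Embedding.coeFn_mk, Function.Embedding.refl_apply, zero_add, x2]
    rw [show (-1 : ℂ) ^ (2 * m + 1 + 1) = 1 by
      rw [pow_succ, pow_succ, pow_mul]; norm_num, one_smul, add_sub_assoc]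
    congr 1
    rw [← Finset.sum_sub_distrib]
    refine Finset.sum_congr rfl fun r hr => ?_
    rw [Finset.HasAntidiagonal.mem_antidiagonal] at hr
    rw [xk _ _ _ (by simp) (by simp; omega)]
    simp only [Nat.succ_eq_add_one, show r.2 + 1 + 2 - 1 = r.2 + 2 from rfl]
    rw [← smul_sub, ← pb_sub, mul_comm (B.1 _) (C.1 1)]
  refine Prod.ext ?_ (Prod.ext ?_ ?_)
  · funext k
    simp only [Prod.fst_add, Pi.add_apply, Prod.fst_zero, Pi.zero_apply]
    by_cases h2 : k = 2
    · subst h2; simp only [x2, x1, y1]; ring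
    by_cases hk : 3 ≤ k ∧ k ≤ 2 * m + 5
    · simp only [xk _ _ _ hk.1 hk.2, x1]
      by_cases h3 : k = 3
      · subst h3; simp only [show 3 - 1 = 2 from rfl, x2]; ring
      · simp only [xk _ _ (k - 1) (by omega) (by omega)]; ring
    · simp [mbr, mx, h2, hk]
  · funext k
    simp only [Prod.fst_add, Prod.snd_add, Pi.add_apply, Prod.fst_zero, Prod.snd_zero,
      Pi.zero_apply]
    by_cases h3 : k = 3
    · subst h3; simp only [y3, x2, y1]; ring
    by_cases hn : k = 2 * m + 5
    · subst hn
      simp only [yn, y1, xk _ _ (2 * m + 4) (by omega) (by omega), e0,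
        show 2 * m + 4 - 1 = 2 * m + 3 from rfl]
      rw [s0_symm m G.1 F.1, s0_symm m H.1 F.1, s0_symm m H.1 G.1]
      ring
    by_cases hn1 : k = 2 * m + 4
    · subst hn1
      have q0 : F.2.1 1 * (mbr (2 * m + 5) a G H).2.1 (2 * m + 3) +
          G.2.1 1 * (mbr (2 * m + 5) a H F).2.1 (2 * m + 3) +
          H.2.1 1 * (mbr (2 * m + 5) a F G).2.1 (2 * m + 3) = 0 := by
        rcases Nat.eq_zero_or_pos m with rfl | hm
        · simp only [mul_zero, zero_add] at y3 ⊢; simp only [y3]; ring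
        · simp only [yk _ _ (2 * m + 3) (by omega) (by omega)]; ring
      have t (A B C : Mdl) : pb (A.1 1) (s0 (2 * m + 5) B.1 C.1) +
          (∑ r ∈ Finset.HasAntidiagonal.antidiagonal (2 * m + 1),
            (-1 : ℂ) ^ r.1 • pb (C.1 (r.1 + 2)) (A.1 1 * B.1 (r.2 + 2))) -
          (∑ r ∈ Finset.HasAntidiagonal.antidiagonal (2 * m + 1),
            (-1 : ℂ) ^ r.1 • pb (B.1 (r.1 + 2)) (A.1 1 * C.1 (r.2 + 2))) = 0 := by
        rw [s1_symm m C.1 B.1 A.1, s0, pb_sum, show 2 * m + 5 - 4 = 2 * m + 1 from rfl,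
          ← sub_eq_add_neg, ← Finset.sum_sub_distrib, ← Finset.sum_sub_distrib]
        refine Finset.sum_eq_zero fun r _ => ?_
        rw [pb_smul, pow_succ, mul_neg_one, neg_smul]
        rw [← smul_neg, ← smul_sub, ← smul_sub]
        convert smul_zero _ using 2
        simp only [pb, Derivation.leibniz, smul_eq_mul]; ring
      have t1 := t F G H
      have t2 := t G H F
      have t3 := t H F G
      simp only [yn1, y1, x1, yn, xk _ _ (2 * m + 5) (by omega) (by omega), e1,
        show 2 * m + 5 - 1 = 2 * m + 4 from rfl, pb_add, pb_zero, MvPolynomial.smul_eq_C_mul]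
      simp only [MvPolynomial.smul_eq_C_mul] at t1 t2 t3
      generalize pb (F.1 1) (s0 (2 * m + 5) G.1 H.1) = S1 at *
      generalize pb (G.1 1) (s0 (2 * m + 5) H.1 F.1) = S2 at *
      generalize pb (H.1 1) (s0 (2 * m + 5) F.1 G.1) = S3 at *
      let R (A B C : Mdl) : Pol :=
        pb (A.1 1) (B.2.1 1 * C.1 (2 * m + 4) - B.1 (2 * m + 4) * C.2.1 1) -
        pb (A.2.1 1) (B.1 1 * C.1 (2 * m + 4) - B.1 (2 * m + 4) * C.1 1) +
        pb (A.1 (2 * m + 4)) (B.1 1 * C.2.1 1 - B.2.1 1 * C.1 1)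
      have rr : R F G H + R G H F + R H F G = 0 := by
        simp only [R, pb, map_sub, Derivation.leibniz, smul_eq_mul]; ring
      simp only [R] at rr
      linear_combination (exp := 1) q0 + MvPolynomial.C a * (t1 + t2 + t3) + MvPolynomial.C a * rr
    by_cases hk : 4 ≤ k ∧ k + 1 < 2 * m + 5
    · simp only [yk _ _ _ hk.1 hk.2, y1]
      by_cases h4 : k = 4
      · subst h4; simp only [show 4 - 1 = 3 from rfl, y3]; ring
      · simp only [yk _ _ (k - 1) (by omega) (by omega)]; ring
    · simp only [mbr, my]
      rw [if_neg h3, if_neg hn, if_neg (by omega), if_neg (by omega)]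
      simp only [if_neg h3, if_neg hn]
      rw [if_neg (by omega), if_neg (by omega), if_neg (by omega), if_neg (by omega)]
      simp
  · simp only [Prod.snd_add, Prod.snd_zero, mbr]
    simp [mx, my, pb_zero]

/-- The monomial corresponding to `x p i`. -/
noncomputable def mono (p i : ℕ) : Pol :=
  MvPolynomial.X 0 ^ (p + 1 - i) * MvPolynomial.X 1 ^ (i - 1)

/-- The element of the model corresponding to a basis vector. -/
noncomputable def tht : Gen → Mdl
  | .c => (0, 0, 1)
  | .x p i => (Pi.single p (mono p i), 0, 0)
  | .y p i => (0, Pi.single p (mono p i), 0)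

/-- The map from `GN(a,b)` to the model. -/
noncomputable def Tht (n : ℕ) : GN n →ₗ[ℂ] Mdl :=
  Finsupp.linearCombination ℂ fun g => tht g.1

theorem Tht_vec (n : ℕ) (g : Gen) (h : g.Valid n) : Tht n (vec n g) = tht g := by
  simp [Tht, vec, h]

/-- The quadratic polynomial corresponding to a basis vector of `sl₂`. -/
noncomputable def slP : Sl → Pol
  | .e => (1 / 2 : ℂ) • MvPolynomial.X 0 ^ 2
  | .h => - (MvPolynomial.X 0 * MvPolynomial.X 1)
  | .f => (-1 / 2 : ℂ) • MvPolynomial.X 1 ^ 2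

theorem mono_mul (p q i j : ℕ) (hj : 1 ≤ j) (hjp : j ≤ p + 1) (hi : 1 ≤ i) (hiq : i ≤ q + 1) :
    mono p j * mono q i = mono (p + q) (i + j - 1) := by
  obtain ⟨r, rfl⟩ := Nat.exists_eq_add_of_le' hj
  obtain ⟨r', rfl⟩ := Nat.exists_eq_add_of_le' hi
  obtain ⟨l, rfl⟩ := Nat.exists_eq_add_of_le' (Nat.le_of_succ_le_succ hjp)
  obtain ⟨l', rfl⟩ := Nat.exists_eq_add_of_le' (Nat.le_of_succ_le_succ hiq)
  simp only [mono]
  rw [show l + r + 1 - (r + 1) = l by omega, show r + 1 - 1 = r by omega,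
    show l' + r' + 1 - (r' + 1) = l' by omega, show r' + 1 - 1 = r' by omega,
    show l + r + (l' + r') + 1 - (r' + 1 + (r + 1) - 1) = l + l' by omega,
    show r' + 1 + (r + 1) - 1 - 1 = r + r' by omega]
  ring

theorem pb_mono (p q i j : ℕ) (hpq : 2 ≤ p + q) (hj : 1 ≤ j) (hjp : j ≤ p + 1) (hi : 1 ≤ i) (hiq : i ≤ q + 1) :
    pb (mono p j) (mono q i) =
      (((i : ℂ) - 1) * p - ((j : ℂ) - 1) * q) • mono (p + q - 2) (i + j - 2) := by
  obtain ⟨r, rfl⟩ := Nat.exists_eq_add_of_le' hj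
  obtain ⟨r', rfl⟩ := Nat.exists_eq_add_of_le' hi
  obtain ⟨l, rfl⟩ := Nat.exists_eq_add_of_le' (Nat.le_of_succ_le_succ hjp)
  obtain ⟨l', rfl⟩ := Nat.exists_eq_add_of_le' (Nat.le_of_succ_le_succ hiq)
  simp only [mono]
  rw [show l + r + 1 - (r + 1) = l by omega, show r + 1 - 1 = r by omega,
    show l' + r' + 1 - (r' + 1) = l' by omega, show r' + 1 - 1 = r' by omega,
    show r' + 1 + (r + 1) - 2 - 1 = r + r' - 1 by omega]
  have hp : pb (MvPolynomial.X 0 ^ l * MvPolynomial.X 1 ^ r)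
      (MvPolynomial.X 0 ^ l' * MvPolynomial.X 1 ^ r') =
      ((l : Pol) * MvPolynomial.X 0 ^ (l - 1) * MvPolynomial.X 1 ^ r) *
        ((r' : Pol) * MvPolynomial.X 0 ^ l' * MvPolynomial.X 1 ^ (r' - 1)) -
      ((r : Pol) * MvPolynomial.X 0 ^ l * MvPolynomial.X 1 ^ (r - 1)) *
        ((l' : Pol) * MvPolynomial.X 0 ^ (l' - 1) * MvPolynomial.X 1 ^ r') := by
    simp [pb, Derivation.leibniz, Derivation.leibniz_pow, MvPolynomial.pderiv_X]
    ring
  rcases Nat.eq_zero_or_pos (l + l') with h0 | h0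
  · obtain ⟨rfl, rfl⟩ : l = 0 ∧ l' = 0 := by omega
    rw [hp, show ((((r' + 1 : ℕ) : ℂ) - 1) * ((0 + r : ℕ) : ℂ) -
      (((r + 1 : ℕ) : ℂ) - 1) * ((0 + r' : ℕ) : ℂ)) = 0 by push_cast; ring]
    simp
  rw [show l + r + (l' + r') - 2 + 1 - (r' + 1 + (r + 1) - 2) = l + l' - 1 by
      clear hp; omega, hp,
    MvPolynomial.smul_eq_C_mul]
  push_cast
  simp only [map_sub, map_mul, map_add, map_natCast, map_one]
  rcases l with _ | l <;> rcases r with _ | r <;> rcases l' with _ | l' <;> rcases r' with _ | r' <;>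
    simp only [Nat.add_sub_cancel, Nat.cast_zero, Nat.zero_add, Nat.add_zero, Nat.cast_add,
      Nat.cast_one, ← Nat.add_assoc, Nat.succ_add] <;> ring_nf
  all_goals simp
  all_goals try ring_nf

theorem s0_single (n p q : ℕ) (hn : 5 ≤ n) (M N : Pol) :
    s0 n (Pi.single p M) (Pi.single q N) =
      if 2 ≤ p ∧ 2 ≤ q ∧ p + q = n then (-1 : ℂ) ^ (p - 1) • (M * N) else 0 := by
  rw [s0]
  split_ifs with h
  · rw [Finset.sum_eq_single (p - 2, q - 2)]
    · simp only [show p - 2 + 2 = p by omega, show q - 2 + 2 = q by omega,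
        show p - 2 + 1 = p - 1 by omega, Pi.single_eq_same]
    · rintro ⟨u, v⟩ _ hne
      by_cases hu : u + 2 = p
      · have hv : v + 2 ≠ q := by
          rintro rfl; apply hne; subst hu; simp
        simp [Pi.single_apply, hv]
      · simp [Pi.single_apply, hu]
    · intro hh
      exact absurd (Finset.HasAntidiagonal.mem_antidiagonal.2 (by simp; omega)) hh
  · refine Finset.sum_eq_zero fun r hr => ?_
    rw [Finset.HasAntidiagonal.mem_antidiagonal] at hr
    by_cases hu : r.1 + 2 = p
    · have hv : r.2 + 2 ≠ q := by omega
      simp [Pi.single_apply, hv]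
    · simp [Pi.single_apply, hu]

theorem s1_single (n p q : ℕ) (hn : 5 ≤ n) (M N : Pol) :
    s1 n (Pi.single p M) (Pi.single q N) =
      if 2 ≤ p ∧ 2 ≤ q ∧ p + q = n + 1 then (-1 : ℂ) ^ p • pb M N else 0 := by
  rw [s1]
  split_ifs with h
  · rw [Finset.sum_eq_single (p - 2, q - 2)]
    · simp only [show p - 2 + 2 = p by omega, show q - 2 + 2 = q by omega, Pi.single_eq_same]
      congr 1
      conv_rhs => rw [show p = p - 2 + 2 by omega, pow_add]
      simp
    · rintro ⟨u, v⟩ _ hne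
      by_cases hu : u + 2 = p
      · have hv : v + 2 ≠ q := by
          rintro rfl; apply hne; subst hu; simp
        simp [Pi.single_apply, hv, pb_zero]
      · simp [Pi.single_apply, hu, pb_zero_left]
    · intro hh
      exact absurd (Finset.HasAntidiagonal.mem_antidiagonal.2 (by simp; omega)) hh
  · refine Finset.sum_eq_zero fun r hr => ?_
    rw [Finset.HasAntidiagonal.mem_antidiagonal] at hr
    by_cases hu : r.1 + 2 = p
    · have hv : r.2 + 2 ≠ q := by omega
      simp [Pi.single_apply, hv, pb_zero]
    · simp [Pi.single_apply, hu, pb_zero_left]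

theorem s0_zero_left (n : ℕ) (v : ℕ → Pol) : s0 n 0 v = 0 := by simp [s0]
theorem s0_zero_right (n : ℕ) (v : ℕ → Pol) : s0 n v 0 = 0 := by simp [s0]
theorem s1_zero_left (n : ℕ) (v : ℕ → Pol) : s1 n 0 v = 0 := by simp [s1, pb_zero_left]
theorem s1_zero_right (n : ℕ) (v : ℕ → Pol) : s1 n v 0 = 0 := by simp [s1, pb_zero]

theorem mbr_x_x (n : ℕ) (a : ℂ) (hn : 5 ≤ n) (p q j i : ℕ) (hq : 1 ≤ q) (hp : 1 ≤ p) :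
    mbr n a (tht (.x p j)) (tht (.x q i)) =
      (fun k => if 3 ≤ k ∧ k ≤ n then (if p = 1 ∧ q + 1 = k then mono p j * mono q i else 0) -
          (if q = 1 ∧ p + 1 = k then mono p j * mono q i else 0) else 0,
       fun k => if k = n then (if 2 ≤ p ∧ 2 ≤ q ∧ p + q = n then
            (-1 : ℂ) ^ (p - 1) • (mono p j * mono q i) else 0)
          else if k + 1 = n then a • (if 2 ≤ p ∧ 2 ≤ q ∧ p + q = n + 1 then
            (-1 : ℂ) ^ p • pb (mono p j) (mono q i) else 0) else 0,
       if p = 1 ∧ q = 1 then pb (mono p j) (mono q i) else 0) := by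
  refine Prod.ext ?_ (Prod.ext ?_ ?_)
  · funext k
    simp only [mbr, mx, tht, Pi.single_apply, Pi.zero_apply]
    split_ifs <;> first | omega | simp
  · funext k
    simp only [mbr, my, tht, Pi.single_apply, Pi.zero_apply, s0_single _ _ _ hn,
      s1_single _ _ _ hn]
    split_ifs <;> first | omega | simp [pb_zero, pb_zero_left]
  · simp only [mbr, tht, Pi.single_apply, Pi.zero_apply]
    split_ifs <;> first | omega | simp [pb_zero, pb_zero_left]

theorem table_r4 (n : ℕ) (a : ℂ) (hn : 5 ≤ n) (p q j i : ℕ) (hpq : p ≤ q) (h2 : 2 ≤ p)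
    (h1 : p + q = n + 1) (hj : 1 ≤ j) (hjp : j ≤ p + 1) (hi : 1 ≤ i) (hiq : i ≤ q + 1) :
    Tht n (table n a a (.x p j) (.x q i)) =
      (0, Pi.single (n - 1) (a • (-1 : ℂ) ^ p • pb (mono p j) (mono q i)), 0) := by
  have hP := pb_mono p q i j (by omega) hj hjp hi hiq
  have hcast : (n : ℂ) = p + q - 1 := by
    rw [eq_sub_iff_add_eq]; exact_mod_cast h1.symm
  have hp0 : (p : ℂ) ≠ 0 := by exact_mod_cast (by omega : p ≠ 0)
  have ht : table n a a (.x p j) (.x q i) =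
      (a * (-1 : ℂ) ^ p * (((i : ℂ) - 1) * p - ((j : ℂ) - 1) * q)) •
        vec n (.y (n - 1) (i + j - 2)) := by
    simp only [table, half]
    rcases Nat.lt_or_ge p q with h | h
    · split_ifs <;> try omega
      rw [sub_zero]; congr 1; rw [hcast]; field_simp; ring
    · have : p = q := by omega
      subst this
      rcases lt_trichotomy j i with h | h | h
      · split_ifs <;> try omega
        rw [sub_zero]; congr 1; rw [hcast]; field_simp; ring
      · subst h
        split_ifs <;> try omega
        simp
      · split_ifs <;> try omega
        rw [zero_sub, ← neg_smul, add_comm j i]; congr 1; rw [hcast]; field_simp; ring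
  rw [show p + q - 2 = n - 1 by omega] at hP
  rw [ht, map_smul]
  by_cases hv : (Gen.y (n - 1) (i + j - 2)).Valid n
  · rw [Tht_vec _ _ hv, tht, hP, smul_smul, smul_smul]
    simp [← Pi.single_smul]
  · have hz : (((i : ℂ) - 1) * p - ((j : ℂ) - 1) * q) = 0 := by
      simp only [Gen.Valid] at hv
      have : (j = 1 ∧ i = 1) ∨ (j = p + 1 ∧ i = q + 1) := by omega
      rcases this with ⟨rfl, rfl⟩ | ⟨rfl, rfl⟩
      · simp
      · push_cast; ring
    rw [hP, hz]
    simp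
    rfl

theorem x_x (n : ℕ) (a : ℂ) (hn : 5 ≤ n) (ho : Odd n) (p q j i : ℕ) (hp : 1 ≤ p)
    (hj : 1 ≤ j) (hjp : j ≤ p + 1) (hq : 1 ≤ q) (hqn : q ≤ n) (hi : 1 ≤ i) (hiq : i ≤ q + 1)
    (hpq : p ≤ q) :
    Tht n (table n a a (.x p j) (.x q i)) = mbr n a (tht (.x p j)) (tht (.x q i)) := by
  have hne : p + q = n → p ≠ q := by
    rintro h rfl
    exact (Nat.not_even_iff_odd.2 ho) ⟨p, h.symm⟩
  rw [mbr_x_x n a hn p q j i hq hp]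
  have hM := mono_mul p q i j hj hjp hi hiq
  have hP := pb_mono p q i j (by omega) hj hjp hi hiq
  by_cases r1 : p = 1 ∧ q = 1
  · obtain ⟨rfl, rfl⟩ := r1
    have ht : table n a a (.x 1 j) (.x 1 i) = ((i : ℂ) - j) • vec n .c := by
      have hj' : j = 1 ∨ j = 2 := by omega
      have hi' : i = 1 ∨ i = 2 := by omega
      rcases hj' with rfl | rfl <;> rcases hi' with rfl | rfl <;> simp [table, half] <;> norm_num
    rw [ht, map_smul, Tht_vec n .c trivial, tht]
    refine Prod.ext ?_ (Prod.ext ?_ ?_)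
    · funext k
      simp only [Prod.smul_fst, Pi.smul_apply, Pi.zero_apply]
      split_ifs <;> first | omega | simp
    · funext k
      simp only [Prod.smul_fst, Prod.smul_snd, Pi.smul_apply, Pi.zero_apply]
      split_ifs <;> first | omega | simp
    · simp only [Prod.smul_snd, hP]
      have hj' : j = 1 ∨ j = 2 := by omega
      have hi' : i = 1 ∨ i = 2 := by omega
      rcases hj' with rfl | rfl <;> rcases hi' with rfl | rfl <;> simp [mono]
  by_cases r2 : p = 1 ∧ q + 1 ≤ n
  · have ht : table n a a (.x p j) (.x q i) = vec n (.x (q + 1) (i + j - 1)) := by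
      simp only [table, half]
      split_ifs <;> first | omega | simp
    have hM' : mono p j * mono q i = mono (q + 1) (i + j - 1) := by rw [hM, r2.1, add_comm]
    rw [ht, Tht_vec _ _ (by simp only [Gen.Valid]; omega), tht]
    refine Prod.ext ?_ (Prod.ext ?_ ?_)
    · funext k
      simp only [Pi.single_apply]
      split_ifs <;> first | omega | simp [hM']
    · funext k
      simp only [Pi.zero_apply]
      split_ifs <;> first | omega | simp
    · simp only []
      split_ifs <;> first | omega | simp
  by_cases r3 : 2 ≤ p ∧ p + q = n
  · have hne := hne r3.2
    have ht : table n a a (.x p j) (.x q i) = (-1 : ℂ) ^ (p - 1) • vec n (.y n (i + j - 1)) := by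
      simp only [table, half]
      split_ifs <;> first | omega | simp
    rw [r3.2] at hM
    rw [ht, map_smul, Tht_vec _ _ (by simp only [Gen.Valid]; omega), tht]
    refine Prod.ext ?_ (Prod.ext ?_ ?_)
    · funext k
      simp only [Prod.smul_fst, Pi.smul_apply, Pi.zero_apply]
      split_ifs <;> first | omega | simp
    · funext k
      simp only [Prod.smul_fst, Prod.smul_snd, Pi.smul_apply, Pi.single_apply]
      split_ifs <;> first | omega | simp [hM]
    · simp only [Prod.smul_snd]
      split_ifs <;> first | omega | simp
  by_cases r4 : 2 ≤ p ∧ p + q = n + 1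
  · rw [table_r4 n a hn p q j i hpq r4.1 r4.2 hj hjp hi hiq]
    refine Prod.ext ?_ (Prod.ext ?_ ?_)
    · funext k
      simp only [Pi.zero_apply]
      split_ifs <;> first | omega | simp
    · funext k
      simp only [Pi.single_apply]
      split_ifs <;> first | omega | rfl
    · simp only []
      split_ifs <;> first | omega | simp
  · have ht : table n a a (.x p j) (.x q i) = 0 := by
      simp only [table, half]
      split_ifs <;> first | omega | simp
    rw [ht, map_zero]
    refine Prod.ext ?_ (Prod.ext ?_ ?_)
    · funext k
      simp only [Prod.fst_zero, Pi.zero_apply]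
      split_ifs <;> first | omega | simp
    · funext k
      simp only [Prod.fst_zero, Prod.snd_zero, Pi.zero_apply]
      split_ifs <;> first | omega | simp
    · simp only [Prod.snd_zero]
      split_ifs <;> first | omega | simp

theorem mbr_skew (m : ℕ) (a : ℂ) (F G : Mdl) :
    mbr (2 * m + 5) a G F = - mbr (2 * m + 5) a F G := by
  have h0 : s0 (2 * m + 5) G.1 F.1 = - s0 (2 * m + 5) F.1 G.1 := by
    rw [s0, s0, ← Finset.Nat.sum_antidiagonal_swap, ← Finset.sum_neg_distrib]
    refine Finset.sum_congr rfl fun r hr => ?_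
    rw [Finset.HasAntidiagonal.mem_antidiagonal] at hr
    have : (-1 : ℂ) ^ (r.2 + 1) = - (-1) ^ (r.1 + 1) := by
      have ho : Odd (r.1 + r.2) := hr ▸ odd_two_mul_add_one m
      rcases Nat.even_or_odd r.1 with h | h
      · have h2 : Odd r.2 := (Nat.odd_add'.1 ho).2 h
        rw [pow_succ, pow_succ, h.neg_one_pow, h2.neg_one_pow]; ring
      · have h2 : Even r.2 := (Nat.odd_add.1 ho).1 h
        rw [pow_succ, pow_succ, h.neg_one_pow, h2.neg_one_pow]; ring
    simp only [Prod.fst_swap, Prod.snd_swap, this, neg_smul]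
    rw [mul_comm]
  have h1 : s1 (2 * m + 5) G.1 F.1 = - s1 (2 * m + 5) F.1 G.1 := by
    rw [s1, s1, ← Finset.Nat.sum_antidiagonal_swap, ← Finset.sum_neg_distrib]
    refine Finset.sum_congr rfl fun r hr => ?_
    rw [Finset.HasAntidiagonal.mem_antidiagonal] at hr
    have : (-1 : ℂ) ^ r.2 = (-1) ^ r.1 := by
      have ho : Even (r.1 + r.2) := hr ▸ even_two_mul (m + 1)
      rcases Nat.even_or_odd r.1 with h | h
      · have h2 : Even r.2 := (Nat.even_add.1 ho).1 h
        rw [h.neg_one_pow, h2.neg_one_pow]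
      · have h2 : Odd r.2 := by
          rw [Nat.even_add] at ho
          rw [← Nat.not_even_iff_odd] at h ⊢
          tauto
        rw [h.neg_one_pow, h2.neg_one_pow]
    simp only [Prod.fst_swap, Prod.snd_swap, this]
    rw [pb_skew, smul_neg]
  refine Prod.ext ?_ (Prod.ext ?_ ?_)
  · funext k
    simp only [mbr, mx, Prod.fst_neg, Pi.neg_apply]
    split_ifs <;> ring
  · funext k
    simp only [mbr, my, Prod.fst_neg, Prod.snd_neg, Pi.neg_apply, h0, h1,
      pb_skew (G.1 1) _, pb_skew (G.2.1 1) _, pb_skew (G.1 (2 * m + 5)) _,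
      pb_skew (G.2.1 (2 * m + 5)) _, MvPolynomial.smul_eq_C_mul]
    split_ifs <;> ring
  · simp only [mbr, Prod.snd_neg]
    rw [pb_skew (G.1 1), pb_skew (G.2.1 1)]; ring

theorem mbr_x_y (n : ℕ) (a : ℂ) (hn : 5 ≤ n) (p q j i : ℕ) :
    mbr n a (tht (.x p j)) (tht (.y q i)) =
      (fun k => if k = 2 ∧ p = 1 ∧ q = 1 then mono p j * mono q i else 0,
       fun k => if k = 3 ∧ p = 2 ∧ q = 1 then - (mono p j * mono q i)
          else if k = n ∧ p + 1 = n ∧ q = 1 then - (mono p j * mono q i)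
          else if k + 1 = n ∧ p = 1 ∧ q = n then a • pb (mono p j) (mono q i)
          else if k + 1 = n ∧ p = n ∧ q = 1 then - (a • pb (mono p j) (mono q i)) else 0, 0) := by
  refine Prod.ext ?_ (Prod.ext ?_ ?_)
  · funext k
    simp only [mbr, mx, tht, Pi.single_apply, Pi.zero_apply]
    split_ifs <;> first | omega | simp
  · funext k
    simp only [mbr, my, tht, Pi.single_apply, Pi.zero_apply, s0_zero_right, s1_zero_right]
    by_cases k3 : k = 3
    · have e1 : ¬ k = n := by omega
      have e2 : ¬ k + 1 = n := by omega
      simp only [k3, if_true, true_and]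
      split_ifs <;> first | omega | simp
    by_cases kn : k = n
    · have e2 : ¬ k + 1 = n := by omega
      simp only [kn, if_true, true_and, k3, if_false, false_and]
      split_ifs <;> first | omega | simp
    by_cases kn1 : k + 1 = n
    · simp only [kn1, if_true, true_and, k3, if_false, false_and, kn]
      split_ifs <;> first | omega | simp [pb_zero, pb_zero_left]
    · simp [k3, kn, kn1]
  · simp [mbr, tht, pb_zero, pb_zero_left]

theorem u_vec (n : ℕ) (hn : 5 ≤ n) (i j : ℕ) (hj : 1 ≤ j) (hjp : j ≤ 1 + 1)
    (hi : 1 ≤ i) (hiq : i ≤ n + 1) :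
    ((i : ℂ) - 1 - ((j : ℂ) - 1) * n) • Tht n (vec n (.y (n - 1) (i + j - 2))) =
      (0, Pi.single (n - 1) (pb (mono 1 j) (mono n i)), 0) := by
  have hP := pb_mono 1 n i j (by omega) hj hjp hi hiq
  rw [show 1 + n - 2 = n - 1 by omega, Nat.cast_one, mul_one] at hP
  by_cases hv : (Gen.y (n - 1) (i + j - 2)).Valid n
  · rw [Tht_vec _ _ hv, tht, hP]
    simp [← Pi.single_smul]
  · have hz : ((i : ℂ) - 1 - ((j : ℂ) - 1) * n) = 0 := by
      simp only [Gen.Valid] at hv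
      have : (j = 1 ∧ i = 1) ∨ (j = 2 ∧ i = n + 1) := by omega
      rcases this with ⟨rfl, rfl⟩ | ⟨rfl, rfl⟩
      · simp
      · push_cast; ring
    rw [hP, hz]
    simp
    rfl

theorem x_y (n : ℕ) (a : ℂ) (hn : 5 ≤ n) (p q j i : ℕ) (hp : 1 ≤ p) (hpn : p ≤ n)
    (hj : 1 ≤ j) (hjp : j ≤ p + 1) (hq : 1 ≤ q) (hqn : q ≤ n) (hi : 1 ≤ i) (hiq : i ≤ q + 1) :
    Tht n (table n a a (.x p j) (.y q i)) = mbr n a (tht (.x p j)) (tht (.y q i)) := by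
  rw [mbr_x_y n a hn]
  have hM := mono_mul p q i j hj hjp hi hiq
  by_cases r1 : p = 1 ∧ q = 1
  · have ht : table n a a (.x p j) (.y q i) = vec n (.x 2 (i + j - 1)) := by
      simp only [table, half]
      split_ifs <;> first | omega | simp
    have hM' : mono p j * mono q i = mono 2 (i + j - 1) := by rw [hM, r1.1, r1.2]
    rw [ht, Tht_vec _ _ (by simp only [Gen.Valid]; omega), tht]
    refine Prod.ext ?_ (Prod.ext ?_ rfl)
    · funext k
      simp only [Pi.single_apply]
      split_ifs <;> first | omega | simp [hM']
    · funext k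
      simp only [Pi.zero_apply]
      split_ifs <;> first | omega | rfl
  by_cases r2 : p = 2 ∧ q = 1
  · have ht : table n a a (.x p j) (.y q i) = - vec n (.y 3 (i + j - 1)) := by
      simp only [table, half]
      split_ifs <;> first | omega | simp [add_comm i j]
    have hM' : mono p j * mono q i = mono 3 (i + j - 1) := by rw [hM, r2.1, r2.2]
    rw [ht, map_neg, Tht_vec _ _ (by simp only [Gen.Valid]; omega), tht]
    refine Prod.ext ?_ (Prod.ext ?_ (by simp))
    · funext k
      simp only [Prod.fst_neg, Pi.neg_apply, Pi.zero_apply]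
      split_ifs <;> first | omega | simp
    · funext k
      simp only [Prod.fst_neg, Prod.snd_neg, Pi.neg_apply, Pi.single_apply]
      split_ifs <;> first | omega | simp [hM']
  by_cases r3 : p + 1 = n ∧ q = 1
  · have ht : table n a a (.x p j) (.y q i) = - vec n (.y n (i + j - 1)) := by
      simp only [table, half]
      split_ifs <;> first | omega | simp [add_comm i j]
    have hM' : mono p j * mono q i = mono n (i + j - 1) := by rw [hM, r3.2, r3.1]
    rw [ht, map_neg, Tht_vec _ _ (by simp only [Gen.Valid]; omega), tht]
    refine Prod.ext ?_ (Prod.ext ?_ (by simp))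
    · funext k
      simp only [Prod.fst_neg, Pi.neg_apply, Pi.zero_apply]
      split_ifs <;> first | omega | simp
    · funext k
      simp only [Prod.fst_neg, Prod.snd_neg, Pi.neg_apply, Pi.single_apply]
      split_ifs <;> first | omega | simp [hM']
  by_cases r4 : p = 1 ∧ q = n
  · have ht : table n a a (.x p j) (.y q i) =
        a • ((i : ℂ) - 1 - ((j : ℂ) - 1) * n) • vec n (.y (n - 1) (i + j - 2)) := by
      rw [smul_smul]
      simp only [table, half]
      split_ifs <;> first | omega | simp
    rw [ht, map_smul, map_smul, u_vec n hn i j hj (by omega) hi (by omega)]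
    have e : pb (mono 1 j) (mono n i) = pb (mono p j) (mono q i) := by rw [r4.1, r4.2]
    rw [e]
    refine Prod.ext ?_ (Prod.ext ?_ (by simp))
    · funext k
      simp only [Prod.smul_fst, Pi.smul_apply, Pi.zero_apply]
      split_ifs <;> first | omega | simp
    · funext k
      simp only [Prod.smul_fst, Prod.smul_snd, Pi.smul_apply, Pi.single_apply]
      split_ifs <;> first | omega | simp
  by_cases r5 : p = n ∧ q = 1
  · have ht : table n a a (.x p j) (.y q i) =
        a • ((j : ℂ) - 1 - ((i : ℂ) - 1) * n) • vec n (.y (n - 1) (j + i - 2)) := by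
      rw [smul_smul]
      simp only [table, half]
      split_ifs <;> first | omega | simp
    rw [ht, map_smul, map_smul, u_vec n hn j i hi (by omega) hj (by omega), pb_skew]
    have e : pb (mono n j) (mono 1 i) = pb (mono p j) (mono q i) := by rw [r5.1, r5.2]
    rw [e]
    refine Prod.ext ?_ (Prod.ext ?_ (by simp))
    · funext k
      simp only [Prod.smul_fst, Pi.smul_apply, Pi.zero_apply]
      split_ifs <;> first | omega | simp
    · funext k
      simp only [Prod.smul_fst, Prod.smul_snd, Pi.smul_apply, Pi.single_apply]
      split_ifs <;> first | omega | simp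
  · have ht : table n a a (.x p j) (.y q i) = 0 := by
      simp only [table, half]
      split_ifs <;> first | omega | simp
    rw [ht, map_zero]
    refine Prod.ext ?_ (Prod.ext ?_ rfl)
    · funext k
      simp only [Prod.fst_zero, Pi.zero_apply]
      split_ifs <;> first | omega | rfl
    · funext k
      simp only [Prod.fst_zero, Prod.snd_zero, Pi.zero_apply]
      split_ifs <;> first | omega | rfl

theorem y_y (n : ℕ) (a : ℂ) (hn : 5 ≤ n) (p q j i : ℕ) (hp : 1 ≤ p) (h2p : p ≠ 2)
    (hj : 1 ≤ j) (hjp : j ≤ p + 1) (hq : 1 ≤ q) (h2q : q ≠ 2)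
    (hi : 1 ≤ i) (hiq : i ≤ q + 1) (hpq : p ≤ q) :
    Tht n (table n a a (.y p j) (.y q i)) = mbr n a (tht (.y p j)) (tht (.y q i)) := by
  have hM := mono_mul p q i j hj hjp hi hiq
  have hbr : mbr n a (tht (.y p j)) (tht (.y q i)) =
      (0, fun k => if k = q + 1 ∧ p = 1 ∧ 3 ≤ q ∧ q + 2 ≤ n then mono p j * mono q i else 0,
        if p = 1 ∧ q = 1 then pb (mono p j) (mono q i) else 0) := by
    refine Prod.ext ?_ (Prod.ext ?_ ?_)
    · funext k
      simp [mbr, mx, tht]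
    · funext k
      simp only [mbr, my, tht, Pi.single_apply, Pi.zero_apply, s0_zero_right, s1_zero_right]
      split_ifs <;> first | omega | simp [pb_zero, pb_zero_left]
    · simp only [mbr, tht, Pi.single_apply, Pi.zero_apply]
      split_ifs <;> first | omega | simp [pb_zero, pb_zero_left]
  rw [hbr]
  clear hbr
  by_cases r1 : p = 1 ∧ q = 1
  · obtain ⟨rfl, rfl⟩ := r1
    have hP := pb_mono 1 1 i j (by omega) hj hjp hi hiq
    have ht : table n a a (.y 1 j) (.y 1 i) = ((i : ℂ) - j) • vec n .c := by
      have hj' : j = 1 ∨ j = 2 := by omega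
      have hi' : i = 1 ∨ i = 2 := by omega
      rcases hj' with rfl | rfl <;> rcases hi' with rfl | rfl <;> simp [table, half] <;> norm_num
    rw [ht, map_smul, Tht_vec n .c trivial, tht]
    refine Prod.ext (by simp) (Prod.ext ?_ ?_)
    · funext k
      simp
    · simp only [Prod.smul_snd, hP]
      have hj' : j = 1 ∨ j = 2 := by omega
      have hi' : i = 1 ∨ i = 2 := by omega
      rcases hj' with rfl | rfl <;> rcases hi' with rfl | rfl <;> simp [mono]
  by_cases r2 : p = 1 ∧ 3 ≤ q ∧ q + 2 ≤ n
  · have ht : table n a a (.y p j) (.y q i) = vec n (.y (q + 1) (i + j - 1)) := by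
      simp only [table, half]
      split_ifs <;> first | omega | simp
    have hM' : mono p j * mono q i = mono (q + 1) (i + j - 1) := by rw [hM, r2.1, add_comm]
    rw [ht, Tht_vec _ _ (by simp only [Gen.Valid]; omega), tht]
    refine Prod.ext rfl (Prod.ext ?_ ?_)
    · funext k
      simp only [Pi.single_apply]
      split_ifs <;> first | omega | simp [hM']
    · simp only []
      split_ifs <;> first | omega | simp
  · have ht : table n a a (.y p j) (.y q i) = 0 := by
      simp only [table, half]
      split_ifs <;> first | omega | simp
    rw [ht, map_zero]
    refine Prod.ext rfl (Prod.ext ?_ ?_)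
    · funext k
      simp only [Prod.fst_zero, Prod.snd_zero, Pi.zero_apply]
      split_ifs <;> first | omega | rfl
    · simp only [Prod.snd_zero]
      split_ifs <;> first | omega | rfl

theorem table_skew (n : ℕ) (a b : ℂ) (g g' : Gen) : table n a b g' g = - table n a b g g' := by
  simp [table]

theorem c_r (n : ℕ) (a b : ℂ) (g : Gen) : table n a b .c g = 0 := by
  cases g <;> simp [table, half]

theorem Tht_table (m : ℕ) (a : ℂ) (g g' : Gen) (h : g.Valid (2 * m + 5))
    (h' : g'.Valid (2 * m + 5)) :
    Tht (2 * m + 5) (table (2 * m + 5) a a g g') = mbr (2 * m + 5) a (tht g) (tht g') := by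
  have ho : Odd (2 * m + 5) := ⟨m + 2, by ring⟩
  have hn : 5 ≤ 2 * m + 5 := by omega
  have hc (g : Gen) : Tht (2 * m + 5) (table (2 * m + 5) a a .c g) =
      mbr (2 * m + 5) a (tht .c) (tht g) := by
    rw [c_r, map_zero]
    refine Prod.ext ?_ (Prod.ext ?_ ?_)
    · funext k; simp [mbr, mx, tht]
    · funext k; simp [mbr, my, tht, s0_zero_left, s1_zero_left, pb_zero_left]
    · simp [mbr, tht, pb_zero_left]
  have sw (g g' : Gen) (H : Tht (2 * m + 5) (table (2 * m + 5) a a g' g) =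
      mbr (2 * m + 5) a (tht g') (tht g)) : Tht (2 * m + 5) (table (2 * m + 5) a a g g') =
      mbr (2 * m + 5) a (tht g) (tht g') := by
    rw [table_skew, map_neg, H, mbr_skew, neg_neg]
  cases g with
  | c => exact hc _
  | x p j =>
    cases g' with
    | c => exact sw _ _ (hc _)
    | x q i =>
      obtain ⟨h1, h2, h3, h4⟩ := h
      obtain ⟨k1, k2, k3, k4⟩ := h'
      rcases le_total p q with hpq | hpq
      · exact x_x _ a hn ho p q j i h1 h3 h4 k1 k2 k3 k4 hpq
      · exact sw _ _ (x_x _ a hn ho q p i j k1 k3 k4 h1 h2 h3 h4 hpq)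
    | y q i =>
      obtain ⟨h1, h2, h3, h4⟩ := h
      obtain ⟨k1, k2, k5, k3, k4⟩ := h'
      exact x_y _ a hn p q j i h1 h2 h3 h4 k1 k2 k3 k4
  | y p j =>
    cases g' with
    | c => exact sw _ _ (hc _)
    | x q i =>
      obtain ⟨h1, h2, h5, h3, h4⟩ := h
      obtain ⟨k1, k2, k3, k4⟩ := h'
      exact sw _ _ (x_y _ a hn q p i j k1 k2 k3 k4 h1 h2 h3 h4)
    | y q i =>
      obtain ⟨h1, h2, h5, h3, h4⟩ := h
      obtain ⟨k1, k2, k5, k3, k4⟩ := h'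
      rcases le_total p q with hpq | hpq
      · exact y_y _ a hn p q j i h1 h5 h3 h4 k1 k5 k3 k4 hpq
      · exact sw _ _ (y_y _ a hn q p i j k1 k5 k3 k4 h1 h5 h3 h4 hpq)

theorem mact_add (u : Pol) (F G : Mdl) : mact u (F + G) = mact u F + mact u G := by
  refine Prod.ext ?_ (Prod.ext ?_ ?_)
  · funext k; exact pb_add _ _ _
  · funext k; exact pb_add _ _ _
  · exact pb_add _ _ _

theorem mact_smul (r : ℂ) (u : Pol) (F : Mdl) : mact u (r • F) = r • mact u F := by
  refine Prod.ext ?_ (Prod.ext ?_ ?_)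
  · funext k; exact pb_smul _ _ _
  · funext k; exact pb_smul _ _ _
  · exact pb_smul _ _ _

theorem mbr_add_left (n : ℕ) (a : ℂ) (F G H : Mdl) :
    mbr n a (F + G) H = mbr n a F H + mbr n a G H := by
  refine Prod.ext ?_ (Prod.ext ?_ ?_)
  · funext k
    simp only [mbr, mx, Prod.fst_add, Prod.snd_add, Pi.add_apply]
    split_ifs <;> ring
  · funext k
    simp only [mbr, my, Prod.fst_add, Prod.snd_add, Pi.add_apply, s0, s1, pb_add_left, add_mul,
      smul_add, Finset.sum_add_distrib, MvPolynomial.smul_eq_C_mul]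
    split_ifs <;> ring
  · simp only [mbr, Prod.fst_add, Prod.snd_add, Pi.add_apply, pb_add_left]; ring

theorem mbr_smul_left (n : ℕ) (a r : ℂ) (F H : Mdl) :
    mbr n a (r • F) H = r • mbr n a F H := by
  refine Prod.ext ?_ (Prod.ext ?_ ?_)
  · funext k
    simp only [mbr, mx, Prod.smul_fst, Prod.smul_snd, Pi.smul_apply,
      MvPolynomial.smul_eq_C_mul]
    split_ifs <;> ring
  · funext k
    have h0 : s0 n (r • F.1) H.1 = MvPolynomial.C r * s0 n F.1 H.1 := by
      simp only [s0, Finset.mul_sum, MvPolynomial.smul_eq_C_mul, Pi.smul_apply]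
      exact Finset.sum_congr rfl fun _ _ => by ring
    have h1 : s1 n (r • F.1) H.1 = MvPolynomial.C r * s1 n F.1 H.1 := by
      simp only [s1, Finset.mul_sum, Pi.smul_apply, pb_smul_left]
      simp only [MvPolynomial.smul_eq_C_mul]
      exact Finset.sum_congr rfl fun _ _ => by ring
    simp only [mbr, my, Prod.smul_fst, Prod.smul_snd, Pi.smul_apply, h0, h1, pb_smul_left]
    simp only [MvPolynomial.smul_eq_C_mul]
    split_ifs <;> ring
  · simp only [mbr, Prod.smul_fst, Prod.smul_snd, Pi.smul_apply, pb_smul_left, smul_add]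

theorem bilin_skew {I V : Type*} [AddCommGroup V] [Module ℂ V] (t : I → I → V)
    (h : ∀ i j, t j i = - t i j) (u v : I →₀ ℂ) : bilin t v u = - bilin t u v := by
  induction u using Finsupp.induction_linear with
  | zero => simp
  | add u u' hu hu' => simp only [map_add, LinearMap.add_apply, hu, hu']; abel
  | single i r =>
    induction v using Finsupp.induction_linear with
    | zero => simp
    | add v v' hv hv' => simp only [map_add, LinearMap.add_apply, hv, hv']; abel
    | single j s => simp [bilin, h i j, smul_comm r s]

theorem Tht_nbr (m : ℕ) (a : ℂ) (u v : GN (2 * m + 5)) :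
    Tht (2 * m + 5) (nbr (2 * m + 5) a a u v) =
      mbr (2 * m + 5) a (Tht (2 * m + 5) u) (Tht (2 * m + 5) v) := by
  have hr (F G H : Mdl) : mbr (2 * m + 5) a H (F + G) =
      mbr (2 * m + 5) a H F + mbr (2 * m + 5) a H G := by
    rw [mbr_skew, mbr_add_left, mbr_skew m a H F, mbr_skew m a H G]; abel
  have hs (r : ℂ) (F H : Mdl) : mbr (2 * m + 5) a H (r • F) = r • mbr (2 * m + 5) a H F := by
    rw [mbr_skew, mbr_smul_left, mbr_skew m a H F, smul_neg, neg_neg]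
  have h0 (H : Mdl) : mbr (2 * m + 5) a 0 H = 0 := by
    have := mbr_smul_left (2 * m + 5) a 0 0 H
    simpa using this
  have h0' (H : Mdl) : mbr (2 * m + 5) a H 0 = 0 := by
    rw [mbr_skew, h0, neg_zero]
  induction u using Finsupp.induction_linear with
  | zero => simp only [map_zero, LinearMap.zero_apply, h0]
  | add u u' hu hu' => simp only [map_add, LinearMap.add_apply, hu, hu', mbr_add_left]
  | single i r =>
    induction v using Finsupp.induction_linear with
    | zero => simp only [map_zero, h0']
    | add v v' hv hv' => simp only [map_add, hv, hv', hr]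
    | single j s =>
      have e1 : Tht (2 * m + 5) (Finsupp.single i r) = r • tht i.1 := by simp [Tht]
      have e2 : Tht (2 * m + 5) (Finsupp.single j s) = s • tht j.1 := by simp [Tht]
      have e3 : nbr (2 * m + 5) a a (Finsupp.single i r) (Finsupp.single j s) =
          r • s • table (2 * m + 5) a a i.1 j.1 := by simp [nbr, bilin]
      rw [e1, e2, e3, map_smul, map_smul, Tht_table m a _ _ i.2 j.2, mbr_smul_left, hs]

/-- The exponent of `mono p i`. -/
noncomputable def expo (p i : ℕ) : Fin 2 →₀ ℕ :=
  Finsupp.single 0 (p + 1 - i) + Finsupp.single 1 (i - 1)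

theorem mono_coeff (p i q j : ℕ) (hi : 1 ≤ i) (hip : i ≤ p + 1) (hj : 1 ≤ j) (hjq : j ≤ q + 1) :
    MvPolynomial.coeff (expo p i) (mono q j) =
      if p = q ∧ i = j then 1 else 0 := by
  have : mono q j = MvPolynomial.monomial
      (Finsupp.single 0 (q + 1 - j) + Finsupp.single 1 (j - 1)) 1 := by
    rw [mono, MvPolynomial.X_pow_eq_monomial, MvPolynomial.X_pow_eq_monomial,
      MvPolynomial.monomial_mul, one_mul]
  rw [this, MvPolynomial.coeff_monomial]
  by_cases h : p = q ∧ i = j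
  · rw [if_pos h, if_pos (by rw [expo, h.1, h.2])]
  · rw [if_neg h, if_neg]
    intro e
    rw [expo] at e
    have e0 := DFunLike.congr_fun e 0
    have e1 := DFunLike.congr_fun e 1
    simp at e0 e1
    omega

theorem Tht_injective (n : ℕ) : Function.Injective (Tht n) := by
  classical
  have hx (p i : ℕ) (h : (Gen.x p i).Valid n) (u : GN n) : MvPolynomial.coeff (expo p i) ((Tht n u).1 p) =
        u ⟨.x p i, h⟩ := by
    induction u using Finsupp.induction_linear with
    | zero => simp
    | add u v hu hv => simp [hu, hv]
    | single g r =>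
      obtain ⟨g, hg⟩ := g
      cases g with
      | c => simp [Tht, tht, Finsupp.single_apply]
      | y q j => simp [Tht, tht, Finsupp.single_apply]
      | x q j =>
        have h' := h; obtain ⟨_, _, h3, h4⟩ := h'
        have hg' := hg; obtain ⟨_, _, k3, k4⟩ := hg'
        by_cases hpq : p = q
        · subst hpq
          simp [Tht, tht, Finsupp.single_apply, mono_coeff p i p j h3 h4 k3 k4, eq_comm]
        · simp [Tht, tht, Finsupp.single_apply, hpq]
  have hy (p i : ℕ) (h : (Gen.y p i).Valid n) (u : GN n) : MvPolynomial.coeff (expo p i) ((Tht n u).2.1 p) =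
        u ⟨.y p i, h⟩ := by
    induction u using Finsupp.induction_linear with
    | zero => simp
    | add u v hu hv => simp [hu, hv]
    | single g r =>
      obtain ⟨g, hg⟩ := g
      cases g with
      | c => simp [Tht, tht, Finsupp.single_apply]
      | x q j => simp [Tht, tht, Finsupp.single_apply]
      | y q j =>
        have h' := h; obtain ⟨_, _, _, h3, h4⟩ := h'
        have hg' := hg; obtain ⟨_, _, _, k3, k4⟩ := hg'
        by_cases hpq : p = q
        · subst hpq
          simp [Tht, tht, Finsupp.single_apply, mono_coeff p i p j h3 h4 k3 k4, eq_comm]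
        · simp [Tht, tht, Finsupp.single_apply, hpq]
  have hc (h : Gen.c.Valid n) (u : GN n) : MvPolynomial.coeff 0 ((Tht n u).2.2) =
        u ⟨.c, h⟩ := by
    induction u using Finsupp.induction_linear with
    | zero => simp
    | add u v hu hv => simp [hu, hv]
    | single g r =>
      obtain ⟨g, hg⟩ := g
      cases g <;> simp [Tht, tht, Finsupp.single_apply]
  intro u v huv
  ext ⟨g, hg⟩
  cases g with
  | c => rw [← hc, ← hc, huv]
  | x p i => rw [← hx, ← hx, huv]
  | y p i => rw [← hy, ← hy, huv]

theorem slP_mono (p i : ℕ) (hi : 1 ≤ i) (hip : i ≤ p + 1) :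
    pb (slP .h) (mono p i) = ((p : ℂ) + 2 - 2 * i) • mono p i ∧
    pb (slP .e) (mono p i) = ((i : ℂ) - 1) • mono p (i - 1) ∧
    pb (slP .f) (mono p i) = ((p : ℂ) + 1 - i) • mono p (i + 1) := by
  have h1 : slP .e = (1 / 2 : ℂ) • mono 2 1 := by simp [slP, mono]
  have h2 : slP .h = - mono 2 2 := by simp [slP, mono]
  have h3 : slP .f = (-1 / 2 : ℂ) • mono 2 3 := by simp [slP, mono]
  rw [h1, h2, h3]
  refine ⟨?_, ?_, ?_⟩
  · have := pb_mono 2 p i 2 (by omega) (by omega) (by omega) hi hip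
    rw [show -mono 2 2 = (-1 : ℂ) • mono 2 2 by simp, pb_smul_left, this, smul_smul,
      show 2 + p - 2 = p by omega, show i + 2 - 2 = i by omega]
    congr 1; push_cast; ring
  · have := pb_mono 2 p i 1 (by omega) (by omega) (by omega) hi hip
    rw [pb_smul_left, this, smul_smul, show 2 + p - 2 = p by omega,
      show i + 1 - 2 = i - 1 by omega]
    congr 1; push_cast; ring
  · have := pb_mono 2 p i 3 (by omega) (by omega) (by omega) hi hip
    rw [pb_smul_left, this, smul_smul, show 2 + p - 2 = p by omega,
      show i + 3 - 2 = i + 1 by omega]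
    congr 1; push_cast; ring

theorem Tht_act (n : ℕ) (s : Sl) (g : Gen) (h : g.Valid n) :
    Tht n (act n s g) = mact (slP s) (tht g) := by
  have Z (r : ℂ) (g : Gen) (hr : ¬ g.Valid n → r = 0) : Tht n (r • vec n g) = r • tht g := by
    by_cases hg : g.Valid n
    · rw [map_smul, Tht_vec _ _ hg]
    · rw [hr hg]; simp
  cases g with
  | c =>
    cases s <;>
    · simp only [act, map_zero, tht, mact]
      refine Prod.ext ?_ (Prod.ext ?_ ?_)
      · funext k; simp [pb_zero]
      · funext k; simp [pb_zero]
      · simp [pb]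
  | x p i =>
    obtain ⟨k1, k2, k3, k4⟩ := h
    obtain ⟨m1, m2, m3⟩ := slP_mono p i k3 k4
    have A (u : Pol) (r : ℂ) (j : ℕ) (hu : pb u (mono p i) = r • mono p j) :
        mact u (tht (.x p i)) = r • tht (.x p j) := by
      refine Prod.ext ?_ (Prod.ext ?_ ?_)
      · funext k
        simp only [mact, tht, Prod.smul_fst, Pi.smul_apply, Pi.single_apply]
        split_ifs
        · exact hu
        · simp [pb_zero]
      · funext k; simp [mact, tht, pb_zero]
      · simp [mact, tht, pb_zero]
    cases s with
    | h => rw [act, A _ _ _ m1, Z]; intro hv; exact absurd ⟨k1, k2, k3, k4⟩ hv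
    | e =>
      rw [act, A _ _ _ m2, Z]; intro hv
      have : i = 1 := by simp only [Gen.Valid] at hv; omega
      simp [this]
    | f =>
      rw [act, A _ _ _ m3, Z]; intro hv
      have : i = p + 1 := by simp only [Gen.Valid] at hv; omega
      simp [this]
  | y p i =>
    obtain ⟨k1, k2, k5, k3, k4⟩ := h
    obtain ⟨m1, m2, m3⟩ := slP_mono p i k3 k4
    have A (u : Pol) (r : ℂ) (j : ℕ) (hu : pb u (mono p i) = r • mono p j) :
        mact u (tht (.y p i)) = r • tht (.y p j) := by
      refine Prod.ext ?_ (Prod.ext ?_ ?_)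
      · funext k; simp [mact, tht, pb_zero]
      · funext k
        simp only [mact, tht, Prod.smul_fst, Prod.smul_snd, Pi.smul_apply, Pi.single_apply]
        split_ifs
        · exact hu
        · simp [pb_zero]
      · simp [mact, tht, pb_zero]
    cases s with
    | h => rw [act, A _ _ _ m1, Z]; intro hv; exact absurd ⟨k1, k2, k5, k3, k4⟩ hv
    | e =>
      rw [act, A _ _ _ m2, Z]; intro hv
      have : i = 1 := by simp only [Gen.Valid] at hv; omega
      simp [this]
    | f =>
      rw [act, A _ _ _ m3, Z]; intro hv
      have : i = p + 1 := by simp only [Gen.Valid] at hv; omega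
      simp [this]

theorem Tht_nact (n : ℕ) (s : Sl) (u : GN n) : Tht n (nact n s u) = mact (slP s) (Tht n u) := by
  induction u using Finsupp.induction_linear with
  | zero =>
    have := mact_smul 0 (slP s) 0
    simp only [zero_smul] at this
    simp only [map_zero, this]
  | add u v hu hv => simp only [map_add, hu, hv, mact_add]
  | single i r =>
    have e1 : Tht n (Finsupp.single i r) = r • tht i.1 := by simp [Tht]
    have e3 : nact n s (Finsupp.single i r) = r • act n s i.1 := by simp [nact]
    rw [e1, e3, map_smul, mact_smul, Tht_act n s _ i.2]

/-- The Jacobi identity in `GN(a,a)`. -/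
theorem nbr_jac (m : ℕ) (a : ℂ) (u v w : GN (2 * m + 5)) :
    nbr (2 * m + 5) a a u (nbr (2 * m + 5) a a v w) +
      nbr (2 * m + 5) a a v (nbr (2 * m + 5) a a w u) +
      nbr (2 * m + 5) a a w (nbr (2 * m + 5) a a u v) = 0 := by
  apply Tht_injective
  simp only [map_add, Tht_nbr, mbr_jac, map_zero]

theorem nbr_skew (n : ℕ) (a b : ℂ) (u v : GN n) : nbr n a b v u = - nbr n a b u v :=
  bilin_skew _ (fun _ _ => table_skew _ _ _ _ _) u v

theorem nact_nbr (m : ℕ) (a : ℂ) (s : Sl) (u v : GN (2 * m + 5)) :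
    nact _ s (nbr (2 * m + 5) a a u v) =
      nbr (2 * m + 5) a a (nact _ s u) v + nbr (2 * m + 5) a a u (nact _ s v) := by
  apply Tht_injective
  simp only [map_add, Tht_nact, Tht_nbr, mact_mbr]

/-- The bracket of two basis vectors of `sl₂`. -/
noncomputable def slTable : Sl → Sl → (Sl →₀ ℂ)
  | .h, .e => Finsupp.single .e 2
  | .e, .h => Finsupp.single .e (-2)
  | .h, .f => Finsupp.single .f (-2)
  | .f, .h => Finsupp.single .f 2
  | .e, .f => Finsupp.single .h 1
  | .f, .e => Finsupp.single .h (-1)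
  | _, _ => 0

theorem slP_lie (s t : Sl) :
    Finsupp.linearCombination ℂ slP (slTable s t) = pb (slP s) (slP t) := by
  have h2 : (MvPolynomial.C (2⁻¹ : ℂ) : Pol) * 2 = 1 := by
    rw [show (2 : Pol) = MvPolynomial.C 2 from rfl, ← map_mul]; norm_num
  have h3 : (MvPolynomial.C (2 : ℂ) : Pol) = 2 := rfl
  have h4 : (MvPolynomial.C (-1 / 2 : ℂ) : Pol) = - MvPolynomial.C (2⁻¹ : ℂ) := by
    rw [← map_neg]; norm_num
  cases s <;> cases t <;>
    simp [slTable, slP, pb, MvPolynomial.pderiv_X, Derivation.leibniz, Derivation.leibniz_pow,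
      MvPolynomial.smul_eq_C_mul, h3, h4]
  all_goals generalize (MvPolynomial.C (2⁻¹ : ℂ) : Pol) = q at *
  all_goals first
    | ring1
    | linear_combination (-(MvPolynomial.X 0 * MvPolynomial.X 1) * (2 * q + 1)) * h2

theorem nact_lie (n : ℕ) (s t : Sl) (u : GN n) :
    Finsupp.linearCombination ℂ (fun r => nact n r u) (slTable s t) =
      nact n s (nact n t u) - nact n t (nact n s u) := by
  apply Tht_injective
  let M : Pol →ₗ[ℂ] Mdl :=
    { toFun := fun p => mact p (Tht n u)
      map_add' := fun p q => by
        refine Prod.ext ?_ (Prod.ext ?_ ?_)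
        · funext k; exact pb_add_left _ _ _
        · funext k; exact pb_add_left _ _ _
        · exact pb_add_left _ _ _
      map_smul' := fun r p => by
        refine Prod.ext ?_ (Prod.ext ?_ ?_)
        · funext k; exact pb_smul_left _ _ _
        · funext k; exact pb_smul_left _ _ _
        · exact pb_smul_left _ _ _ }
  have hM : mact (pb (slP s) (slP t)) (Tht n u) = M (pb (slP s) (slP t)) := rfl
  rw [map_sub, Tht_nact, Tht_nact, Tht_nact, Tht_nact, ← mact_comm, hM, ← slP_lie,
    Finsupp.apply_linearCombination, Finsupp.apply_linearCombination]
  congr 2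
  funext r
  exact Tht_nact n r u

theorem mbr_congr (n : ℕ) (hn : 5 ≤ n) (a : ℂ) (F P Q : Mdl) (h1 : P.1 = Q.1)
    (h2 : ∀ k, k + 1 ≠ n → P.2.1 k = Q.2.1 k) : mbr n a F P = mbr n a F Q := by
  have h3 := h2 1 (by omega)
  have h4 := h2 n (by omega)
  refine Prod.ext ?_ (Prod.ext ?_ ?_)
  · funext k
    simp only [mbr, mx, h1, h3]
  · funext k
    simp only [mbr, my, h1, h3, h4]
    by_cases hk : 4 ≤ k ∧ k + 1 ≤ n
    · rw [h2 (k - 1) (by omega)]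
    · simp only [if_neg hk]
  · simp only [mbr, h1, h3]

theorem mbr_change (n : ℕ) (hn : 5 ≤ n) (a a' : ℂ) (F G H : Mdl) :
    mbr n a F (mbr n a' G H) = mbr n a F (mbr n a G H) :=
  mbr_congr n hn a F _ _ rfl fun k hk => by simp only [mbr, my, if_neg hk]

theorem nbr_change (m : ℕ) (a a' : ℂ) (u v w : GN (2 * m + 5)) :
    nbr (2 * m + 5) a a u (nbr (2 * m + 5) a' a' v w) =
      nbr (2 * m + 5) a a u (nbr (2 * m + 5) a a v w) := by
  apply Tht_injective
  simp only [Tht_nbr]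
  exact mbr_change _ (by omega) _ _ _ _ _

/-- The two semidirect product signs: in `A ⋊ B` the factor `A` is the ideal (on which `B` acts),
in `A ⋉ B` the factor `B` is the ideal. -/
inductive Op where
  | rtimes : Op
  | ltimes : Op

/-- In `N 0 * (N 1 * (⋯ * N (k - 1)))`, where `op s` is the sign between `N s` and the bracketed
factor `N (s + 1) * ⋯` (so `op (k - 1)` is not used), the bracket of `N s` and `N t` lies in
`N (ideal op s t)`. -/
def ideal {k : ℕ} (op : Fin k → Op) (s t : Fin k) : Fin k :=
  if s ≤ t then
    (match op s with
      | .rtimes => s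
      | .ltimes => t)
  else
    (match op t with
      | .rtimes => t
      | .ltimes => s)

/-- Labels of the basis of `sl₂ ⋉ (GN(a₁,b₁) * ⋯ * GN(a_k,b_k))`. -/
inductive LIdx (n k : ℕ) where
  | sl : Sl → LIdx n k
  | nil : Fin k → {g : Gen // g.Valid n} → LIdx n k

/-- The inclusion of the `s`-th copy. -/
noncomputable def inc (n k : ℕ) (s : Fin k) : GN n →ₗ[ℂ] (LIdx n k →₀ ℂ) :=
  Finsupp.lmapDomain ℂ ℂ (LIdx.nil s)

/-- The inclusion of `sl₂`. -/
noncomputable def incSl (n k : ℕ) : (Sl →₀ ℂ) →ₗ[ℂ] (LIdx n k →₀ ℂ) :=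
  Finsupp.lmapDomain ℂ ℂ LIdx.sl

/-- The multiplication table of `sl₂ ⋉ (GN(a₁,b₁) * ⋯ * GN(a_k,b_k))`. An element of one copy acts
on another copy as the element with the same coordinates there. -/
noncomputable def lTable (n k : ℕ) (a b : Fin k → ℂ) (op : Fin k → Op) :
    LIdx n k → LIdx n k → (LIdx n k →₀ ℂ)
  | .sl s, .sl t => incSl n k (slTable s t)
  | .sl s, .nil t g => inc n k t (act n s g.1)
  | .nil t g, .sl s => - inc n k t (act n s g.1)
  | .nil s g, .nil t g' =>
      inc n k (ideal op s t) (table n (a (ideal op s t)) (b (ideal op s t)) g.1 g'.1)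

/-- The bracket on `sl₂ ⋉ (GN(a₁,b₁) * ⋯ * GN(a_k,b_k))`. -/
noncomputable def lbr (n k : ℕ) (a b : Fin k → ℂ) (op : Fin k → Op) :
    (LIdx n k →₀ ℂ) →ₗ[ℂ] (LIdx n k →₀ ℂ) →ₗ[ℂ] (LIdx n k →₀ ℂ) :=
  bilin (lTable n k a b op)

theorem ideal_comm {k : ℕ} (op : Fin k → Op) (s t : Fin k) : ideal op s t = ideal op t s := by
  rcases lt_trichotomy s t with h | h | h
  · simp [ideal, h.le, not_le.2 h]
  · rw [h]
  · simp [ideal, h.le, not_le.2 h]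

theorem ideal_assoc {k : ℕ} (op : Fin k → Op) (s t r : Fin k) :
    ideal op s (ideal op t r) = ideal op t (ideal op r s) := by
  simp only [ideal]
  grind

theorem slTable_skew (s t : Sl) : slTable t s = - slTable s t := by
  cases s <;> cases t <;> simp [slTable]

section
variable {n k : ℕ} (a b : Fin k → ℂ) (op : Fin k → Op)

theorem lbr_skew (u v : LIdx n k →₀ ℂ) : lbr n k a b op v u = - lbr n k a b op u v := by
  refine bilin_skew _ (fun i j => ?_) u v
  cases i <;> cases j
  · rename_i s t
    simp only [lTable]
    rw [slTable_skew s t, map_neg]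
  · simp only [lTable]
  · simp only [lTable, neg_neg]
  · simp only [lTable]
    rw [ideal_comm op, table_skew, map_neg]

theorem lbr_sl_inc (s : Sl) (t : Fin k) (u : GN n) :
    lbr n k a b op (Finsupp.single (.sl s) 1) (inc n k t u) = inc n k t (nact n s u) := by
  induction u using Finsupp.induction_linear with
  | zero => simp
  | add u v hu hv => simp only [map_add, hu, hv]
  | single i r => simp [inc, lbr, bilin, lTable, nact]

theorem lbr_incSl_inc (x : Sl →₀ ℂ) (t : Fin k) (u : GN n) :
    lbr n k a b op (incSl n k x) (inc n k t u) =
      inc n k t (Finsupp.linearCombination ℂ (fun r => nact n r u) x) := by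
  induction x using Finsupp.induction_linear with
  | zero => simp
  | add x y hx hy => simp only [map_add, LinearMap.add_apply, hx, hy]
  | single i r =>
    have := lbr_sl_inc a b op i t u
    have e : incSl n k (Finsupp.single i r) = r • Finsupp.single (.sl i) 1 := by simp [incSl]
    rw [e, map_smul, LinearMap.smul_apply, this]
    simp

theorem lbr_inc_inc (s t : Fin k) (u v : GN n) :
    lbr n k a b op (inc n k s u) (inc n k t v) =
      inc n k (ideal op s t) (nbr n (a (ideal op s t)) (b (ideal op s t)) u v) := by
  induction u using Finsupp.induction_linear with
  | zero => simp
  | add u u' hu hu' => simp only [map_add, LinearMap.add_apply, hu, hu']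
  | single i r =>
    induction v using Finsupp.induction_linear with
    | zero => simp
    | add v v' hv hv' => simp only [map_add, hv, hv']
    | single j r' => simp [inc, lbr, bilin, lTable, nbr]

end

theorem lbr_jac_basis (m k : ℕ) (a : Fin k → ℂ) (op : Fin k → Op) (i j l : LIdx (2 * m + 5) k) :
    lbr _ k a a op (Finsupp.single i 1)
        (lbr _ k a a op (Finsupp.single j 1) (Finsupp.single l 1)) +
      lbr _ k a a op (Finsupp.single j 1)
        (lbr _ k a a op (Finsupp.single l 1) (Finsupp.single i 1)) +
      lbr _ k a a op (Finsupp.single l 1)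
        (lbr _ k a a op (Finsupp.single i 1) (Finsupp.single j 1)) = 0 := by
  have en (s : Fin k) (g : {g : Gen // g.Valid (2 * m + 5)}) :
      (Finsupp.single (.nil s g) 1 : LIdx (2 * m + 5) k →₀ ℂ) =
        inc _ k s (Finsupp.single g 1) := by simp [inc]
  have ess (s t : Sl) : lbr (2 * m + 5) k a a op (Finsupp.single (.sl s) 1)
      (Finsupp.single (.sl t) 1) = incSl _ k (slTable s t) := by simp [lbr, bilin, lTable]
  have e2 (s t : Sl) (r : Fin k) (u : GN (2 * m + 5)) :
      lbr _ k a a op (Finsupp.single (.sl s) 1)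
        (lbr _ k a a op (Finsupp.single (.sl t) 1) (inc _ k r u)) +
      lbr _ k a a op (Finsupp.single (.sl t) 1)
        (lbr _ k a a op (inc _ k r u) (Finsupp.single (.sl s) 1)) +
      lbr _ k a a op (inc _ k r u)
        (lbr _ k a a op (Finsupp.single (.sl s) 1) (Finsupp.single (.sl t) 1)) = 0 := by
    rw [ess, lbr_skew a a op (incSl _ k (slTable s t)) (inc _ k r u), lbr_incSl_inc, nact_lie,
      lbr_skew a a op (Finsupp.single (.sl s) 1) (inc _ k r u), map_neg]
    simp only [lbr_sl_inc, map_sub]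
    abel
  have e1 (s : Sl) (t r : Fin k) (u v : GN (2 * m + 5)) :
      lbr _ k a a op (Finsupp.single (.sl s) 1)
        (lbr _ k a a op (inc _ k t u) (inc _ k r v)) +
      lbr _ k a a op (inc _ k t u)
        (lbr _ k a a op (inc _ k r v) (Finsupp.single (.sl s) 1)) +
      lbr _ k a a op (inc _ k r v)
        (lbr _ k a a op (Finsupp.single (.sl s) 1) (inc _ k t u)) = 0 := by
    rw [lbr_skew a a op (Finsupp.single (.sl s) 1) (inc _ k r v), map_neg]
    simp only [lbr_sl_inc, lbr_inc_inc, nact_nbr, map_add, ideal_comm op r t]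
    rw [nbr_skew _ _ _ (nact _ s u) v, map_neg]
    abel
  have e0 (s t r : Fin k) (u v w : GN (2 * m + 5)) :
      lbr _ k a a op (inc _ k s u) (lbr _ k a a op (inc _ k t v) (inc _ k r w)) +
      lbr _ k a a op (inc _ k t v) (lbr _ k a a op (inc _ k r w) (inc _ k s u)) +
      lbr _ k a a op (inc _ k r w) (lbr _ k a a op (inc _ k s u) (inc _ k t v)) = 0 := by
    simp only [lbr_inc_inc]
    rw [ideal_assoc op s t r, ideal_assoc op t r s,
      nbr_change m _ (a (ideal op t r)), nbr_change m _ (a (ideal op r s)),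
      nbr_change m _ (a (ideal op s t)), ← map_add, ← map_add, nbr_jac, map_zero]
  have cyc {V : Type} [AddCommGroup V] {x y z : V} (h : x + y + z = 0) : y + z + x = 0 := by
    rw [← h]; abel
  cases i <;> cases j <;> cases l
  · rename_i s t r
    have es (s : Sl) (x : Sl →₀ ℂ) : lbr (2 * m + 5) k a a op (Finsupp.single (.sl s) 1)
        (incSl _ k x) = incSl _ k (Finsupp.linearCombination ℂ (slTable s) x) := by
      induction x using Finsupp.induction_linear with
      | zero => simp
      | add x y hx hy => simp only [map_add, hx, hy]
      | single i r => simp [incSl, lbr, bilin, lTable]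
    simp only [ess, es, ← map_add]
    cases s <;> cases t <;> cases r <;> simp [slTable]
  · rename_i s t r g
    rw [en r g]; exact e2 s t r _
  · rename_i s t g r
    rw [en t g]; exact cyc (e2 r s t _)
  · rename_i s t g r g'
    rw [en t g, en r g']; exact e1 s t r _ _
  · rename_i s g t r
    rw [en s g]; exact cyc (cyc (e2 t r s _))
  · rename_i s g t r g'
    rw [en s g, en r g']; exact cyc (cyc (e1 t r s _ _))
  · rename_i s g t g' r
    rw [en s g, en t g']; exact cyc (e1 r s t _ _)
  · rename_i s g t g' r g''
    rw [en s g, en t g', en r g'']; exact e0 s t r _ _ _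

theorem lbr_jac (m k : ℕ) (a : Fin k → ℂ) (op : Fin k → Op) (u v w : LIdx (2 * m + 5) k →₀ ℂ) :
    lbr _ k a a op u (lbr _ k a a op v w) + lbr _ k a a op v (lbr _ k a a op w u) +
      lbr _ k a a op w (lbr _ k a a op u v) = 0 := by
  induction u using Finsupp.induction_linear with
  | zero => simp
  | add u u' hu hu' =>
    have := congrArg₂ (· + ·) hu hu'
    simp only [map_add, LinearMap.add_apply, add_zero] at this ⊢
    rw [← this]; abel
  | single i r =>
    induction v using Finsupp.induction_linear with
    | zero => simp
    | add v v' hv hv' =>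
      have := congrArg₂ (· + ·) hv hv'
      simp only [map_add, LinearMap.add_apply, add_zero] at this ⊢
      rw [← this]; abel
    | single j r' =>
      induction w using Finsupp.induction_linear with
      | zero => simp
      | add w w' hw hw' =>
        have := congrArg₂ (· + ·) hw hw'
        simp only [map_add, LinearMap.add_apply, add_zero] at this ⊢
        rw [← this]; abel
      | single l r'' =>
        have h := congrArg (fun z => (r * r' * r'') • z) (lbr_jac_basis m k a op i j l)
        have ei : (Finsupp.single i r : LIdx (2 * m + 5) k →₀ ℂ) = r • Finsupp.single i 1 := by simp
        have ej : (Finsupp.single j r' : LIdx (2 * m + 5) k →₀ ℂ) = r' • Finsupp.single j 1 := by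
          simp
        have el : (Finsupp.single l r'' : LIdx (2 * m + 5) k →₀ ℂ) = r'' • Finsupp.single l 1 := by
          simp
        rw [ei, ej, el]
        simp only [map_smul, LinearMap.smul_apply, smul_smul, smul_add, smul_zero] at h ⊢
        rw [← h]
        congr 1
        · congr 1 <;> congr 1 <;> ring
        · congr 1; ring

theorem table_special (m : ℕ) (a b : ℂ) :
    table (2 * m + 5) a b (.y 1 2) (.x (2 * m + 4) 1) = vec _ (.y (2 * m + 5) 2) ∧
    table (2 * m + 5) a b (.x (2 * m + 4) 1) (.x 1 1) = - vec _ (.x (2 * m + 5) 1) ∧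
    table (2 * m + 5) a b (.x 1 1) (.y 1 2) = vec _ (.x 2 2) ∧
    table (2 * m + 5) a b (.x 1 1) (.y (2 * m + 5) 2) = a • vec _ (.y (2 * m + 4) 1) ∧
    table (2 * m + 5) a b (.y 1 2) (.x (2 * m + 5) 1) =
      (b * (2 * m + 5)) • vec _ (.y (2 * m + 4) 1) ∧
    table (2 * m + 5) a b (.x (2 * m + 4) 1) (.x 2 2) =
      ((a + b) / 2 * (2 * m + 4)) • vec _ (.y (2 * m + 4) 1) := by
  refine ⟨?_, ?_, ?_, ?_, ?_, ?_⟩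
  · simp [table, half]
  · simp [table, half]
  · simp [table, half]
  · simp [table, half]
    congr 1
    ring
  · simp [table, half]
    congr 1
    ring
  · have h2 : 2 + (2 * m + 4) = 2 * m + 5 + 1 := by omega
    have h3 : (2 * m + 4 : ℕ) ≠ 1 := by omega
    simp [table, half, h2, h3]
    congr 1
    ring

/-- The multiplication table defines a Lie algebra exactly when `a s = b s` for all `s`. -/
theorem jacobi_iff (n k : ℕ) (hn : 5 ≤ n) (ho : Odd n) (a b : Fin k → ℂ) (op : Fin k → Op) :
    (∀ u v w : LIdx n k →₀ ℂ, lbr n k a b op u (lbr n k a b op v w) +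
      lbr n k a b op v (lbr n k a b op w u) + lbr n k a b op w (lbr n k a b op u v) = 0) ↔
    ∀ s, a s = b s := by
  obtain ⟨m, rfl⟩ : ∃ m, n = 2 * m + 5 := by
    obtain ⟨t, rfl⟩ := ho
    exact ⟨t - 2, by omega⟩
  constructor
  · intro h s
    have hs : ideal op s s = s := by simp only [ideal]; split_ifs <;> cases op s <;> rfl
    have := h (inc _ k s (Finsupp.single ⟨.x 1 1, by simp only [Gen.Valid]; omega⟩ 1))
      (inc _ k s (Finsupp.single ⟨.y 1 2, by simp only [Gen.Valid]; omega⟩ 1))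
      (inc _ k s (Finsupp.single ⟨.x (2 * m + 4) 1, by simp only [Gen.Valid]; omega⟩ 1))
    simp only [lbr_inc_inc, hs, ← map_add] at this
    have hinj : Function.Injective (inc (2 * m + 5) k s) :=
      Finsupp.mapDomain_injective (fun _ _ e => by injection e)
    have h0 := hinj (this.trans (map_zero _).symm)
    have V (g : Gen) (hg : g.Valid (2 * m + 5)) : vec (2 * m + 5) g = Finsupp.single ⟨g, hg⟩ 1 := by
      simp [vec, hg]
    have N (g g' : Gen) (hg : g.Valid (2 * m + 5)) (hg' : g'.Valid (2 * m + 5)) :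
        nbr (2 * m + 5) (a s) (b s) (vec _ g) (vec _ g') = table (2 * m + 5) (a s) (b s) g g' := by
      rw [V _ hg, V _ hg', nbr, bilin_single]
    simp only [← V] at h0
    obtain ⟨t1, t2, t3, t4, t5, t6⟩ := table_special m (a s) (b s)
    rw [N _ _ (by simp only [Gen.Valid]; omega) (by simp only [Gen.Valid]; omega), t1,
      N _ _ (by simp only [Gen.Valid]; omega) (by simp only [Gen.Valid]; omega), t4,
      N _ _ (by simp only [Gen.Valid]; omega) (by simp only [Gen.Valid]; omega), t2, map_neg,
      N _ _ (by simp only [Gen.Valid]; omega) (by simp only [Gen.Valid]; omega), t5,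
      N _ _ (by simp only [Gen.Valid]; omega) (by simp only [Gen.Valid]; omega), t3,
      N _ _ (by simp only [Gen.Valid]; omega) (by simp only [Gen.Valid]; omega), t6,
      V _ (by simp only [Gen.Valid]; omega)] at h0
    have h1 := DFunLike.congr_fun h0 ⟨.y (2 * m + 4) 1, by simp only [Gen.Valid]; omega⟩
    simp at h1
    have h2 : (a s - b s) * ((m : ℂ) + 3) = 0 := by linear_combination h1
    have h3 : (m : ℂ) + 3 ≠ 0 := by exact_mod_cast (by omega : m + 3 ≠ 0)
    exact sub_eq_zero.1 ((mul_eq_zero.1 h2).resolve_right h3)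
  · intro h
    obtain rfl : a = b := funext h
    exact lbr_jac m k a op

theorem eq_zero_of_eq_neg {V : Type*} [AddCommGroup V] [Module ℂ V] {x : V} (h : x = -x) :
    x = 0 := by
  have h2 : (2 : ℂ) • x = 0 := by
    rw [two_smul]
    nth_rewrite 2 [h]
    exact add_neg_cancel x
  exact (smul_eq_zero.1 h2).resolve_left two_ne_zero

/-- The data of an algebra in the family `sl₂G(a_i,b_i)`. The condition `a s = b s` says exactly
that the multiplication table satisfies the Jacobi identity, see `jacobi_iff`. -/
structure Params where
  /-- The nilpotency parameter `n` of each copy of `GN`. -/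
  n : ℕ
  /-- The number of copies. -/
  k : ℕ
  five_le : 5 ≤ n
  odd : Odd n
  k_pos : 0 < k
  a : Fin k → ℂ
  b : Fin k → ℂ
  /-- The signs `*`; the last one is not used. -/
  op : Fin k → Op
  a_eq_b : ∀ s, a s = b s

/-- The Lie algebra `sl₂ ⋉ (GN(a₁,b₁) * ⋯ * GN(a_k,b_k))`. -/
def Params.Alg (D : Params) : Type := LIdx D.n D.k →₀ ℂ

namespace Params
variable (D : Params)

noncomputable instance : AddCommGroup D.Alg := inferInstanceAs (AddCommGroup (LIdx D.n D.k →₀ ℂ))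

noncomputable instance : Module ℂ D.Alg := inferInstanceAs (Module ℂ (LIdx D.n D.k →₀ ℂ))

/-- The bracket of `D.Alg` as a bilinear map. -/
noncomputable def br : D.Alg →ₗ[ℂ] D.Alg →ₗ[ℂ] D.Alg := lbr D.n D.k D.a D.b D.op

theorem br_skew (u v : D.Alg) : D.br v u = - D.br u v := lbr_skew D.a D.b D.op u v

theorem br_jac (u v w : D.Alg) :
    D.br u (D.br v w) + D.br v (D.br w u) + D.br w (D.br u v) = 0 :=
  (jacobi_iff D.n D.k D.five_le D.odd D.a D.b D.op).2 D.a_eq_b u v w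

noncomputable instance : LieRing D.Alg where
  bracket u v := D.br u v
  add_lie u v w := by simp only [map_add, LinearMap.add_apply]
  lie_add u v w := by simp only [map_add]
  lie_self u := eq_zero_of_eq_neg (D.br_skew u u)
  leibniz_lie u v w := by
    have h := D.br_jac u v w
    rw [D.br_skew u w, D.br_skew (D.br u v) w, map_neg] at h
    rw [← sub_eq_zero, ← h]
    abel

theorem lie_eq (u v : D.Alg) : ⁅u, v⁆ = D.br u v := rfl

noncomputable instance : LieAlgebra ℂ D.Alg where
  lie_smul r u v := by simp only [lie_eq, map_smul]

/-- The basis vector of `D.Alg` with a given label. -/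
noncomputable def basisVec (i : LIdx D.n D.k) : D.Alg := Finsupp.single i (1 : ℂ)

/-- Coefficients of the cocycle, each pair in one order only. -/
def psiHalf : Gen → Gen → ℂ
  | .x 1 1, .y 1 2 => 1
  | .x 1 2, .y 1 1 => -1
  | _, _ => 0

/-- The values of the cocycle on basis vectors: the value is
`c` on `(x₁, y₂)` and `-c` on `(x₂, y₁)`, for the elements `x_i, y_i, c` of the first copy of `GN`,
and the other values are `0`, up to skew-symmetry. -/
noncomputable def psiTable : LIdx D.n D.k → LIdx D.n D.k → D.Alg
  | .nil s g, .nil t g' =>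
      if s.val = 0 ∧ t.val = 0 then
        (psiHalf g.1 g'.1 - psiHalf g'.1 g.1) • D.basisVec (.nil s ⟨.c, trivial⟩)
      else 0
  | _, _ => 0

theorem psiTable_skew (i j : LIdx D.n D.k) : D.psiTable j i = - D.psiTable i j := by
  cases i <;> cases j <;> simp only [psiTable, neg_zero]
  rename_i s g t g'
  by_cases h : s.val = 0 ∧ t.val = 0
  · obtain rfl : s = t := Fin.ext (h.1.trans h.2.symm)
    rw [if_pos h, if_pos h, ← neg_smul, neg_sub]
  · rw [if_neg h, if_neg (fun e => h ⟨e.2, e.1⟩), neg_zero]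

/-- The `2`-cochain `Ψ` of `D.Alg` with values in the adjoint module. -/
noncomputable def psi : LieModule.Cohomology.twoCochain ℂ D.Alg D.Alg :=
  ⟨bilin D.psiTable, fun u => eq_zero_of_eq_neg (bilin_skew D.psiTable D.psiTable_skew u u)⟩

end Params

section
variable (R L M : Type) [CommRing R] [LieRing L] [LieAlgebra R L] [AddCommGroup M] [Module R M]
  [LieRingModule L M] [LieModule R L M]

noncomputable instance : AddCommGroup (LieModule.Cohomology.twoCocycle R L M) :=
  Module.addCommMonoidToAddCommGroup R

/-- The second cohomology of a Lie algebra with coefficients in a module: cocycles modulo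
coboundaries. -/
abbrev H2 : Type :=
  LieModule.Cohomology.twoCocycle R L M ⧸
    (LinearMap.range (LieModule.Cohomology.d₁₂ R L M)).submoduleOf
      (LieModule.Cohomology.twoCocycle R L M)

end

section
variable (L : Type) [LieRing L] [LieAlgebra ℂ L]

/-- Formal deformations `μ 0 + μ 1 t + μ 2 t² + ⋯` of a Lie algebra, with `μ 0` its bracket: the
skew-symmetric bracket on `L[[t]]` so defined satisfies the Jacobi identity. -/
def IsFormalDeformation (μ : ℕ → LieModule.Cohomology.twoCochain ℂ L L) : Prop :=
  (∀ x y, μ 0 x y = ⁅x, y⁆) ∧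
  ∀ (m : ℕ) (x y z : L), ∑ p ∈ Finset.HasAntidiagonal.antidiagonal m,
    (μ p.1 (μ p.2 x y) z + μ p.1 (μ p.2 y z) x + μ p.1 (μ p.2 z x) y) = 0

/-- A formal deformation is trivial if some `id + φ 1 t + φ 2 t² + ⋯` is an isomorphism from it to
the constant deformation. -/
def IsTrivialDeformation (μ : ℕ → LieModule.Cohomology.twoCochain ℂ L L) : Prop :=
  ∃ φ : ℕ → L →ₗ[ℂ] L, φ 0 = LinearMap.id ∧
    ∀ (m : ℕ) (x y : L), ∑ p ∈ Finset.HasAntidiagonal.antidiagonal m, φ p.1 (μ p.2 x y) =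
      ∑ p ∈ Finset.HasAntidiagonal.antidiagonal m, ⁅φ p.1 x, φ p.2 y⁆

/-- A Lie algebra is (formally) rigid if each of its formal deformations is trivial. -/
def Rigid : Prop :=
  ∀ μ : ℕ → LieModule.Cohomology.twoCochain ℂ L L,
    IsFormalDeformation L μ → IsTrivialDeformation L μ

end

end Sato

/-!
Write `L` for the Lie algebra and `Ψ` for the cochain. In the coordinates `X_i`, `Y_i` of `x_i`,
`y_i` in the first copy of `GN`,
`Ψ(u, v) = (X₁(u) Y₂(v) - X₂(u) Y₁(v) - X₁(v) Y₂(u) + X₂(v) Y₁(u)) c`, see `Params.psi_apply`.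

The vector `c` is central and has no degree-one coordinates, so `[u, Ψ(v, w)] = 0` and
`Ψ(Ψ(u, v), w) = 0`. Vectors of degree one never occur in a product of `GN(a,b)`; hence `X` and `Y`,
evaluated on a bracket, only see the action of `sl₂` on its standard representation
(`Params.isStandardPair_coord`). As `Ψ` is built from the invariant area form on that
representation, invariance and the cocycle identity follow, and `[,] + t Ψ` is a formal deformation.

If `Ψ = dφ`, then evaluation at `(x₁, y₂)` and `(x₂, y₁)`, where the brackets agree, shows that the
traces of the `x → y` and `y → x` parts of `φ` in degree one add up to `2`. They are in fact `0`:
`[y_j, x_1^3] = 0` and `[x_1^3, x_j] ≠ 0` force the `y → x` part to vanish, and `[x_j, y_i^3] = 0`,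
`[y_i^3, y_j] ≠ 0` do the same for the other one; for `n = 5` the products of `x_j` with the
`y^5`-part of `φ y_i^3` interfere, but they are eliminated by combining the cases `i = 1` and
`i = 4`. With several copies of `GN`, the coordinates of `φ` have to be summed over the first copy
and all copies that act on it (`Params.pooledCoord`). See `Params.psi_notMem_range`.

The first-order term of a trivialization of `[,] + t Ψ` would be a `φ` with `Ψ = dφ`, so `L` is not
rigid; and since `L` is finite-dimensional, the nonzero class of `Ψ` gives `dim H² ≥ 1`.
-/

namespace Sato

/-! ### Coordinates -/

open Classical in
/-- The coordinate of a label in `GN(a,b)`, as a linear functional; it is `0` if the label does not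
occur. -/
noncomputable def coeffGN (n : ℕ) (g : Gen) : GN n →ₗ[ℂ] ℂ :=
  if h : g.Valid n then Finsupp.lapply ⟨g, h⟩ else 0

open Classical in
theorem coeffGN_vec (n : ℕ) (g g' : Gen) (h : g.Valid n) :
    coeffGN n g (vec n g') = if g' = g then 1 else 0 := by
  by_cases h' : g'.Valid n
  · simp [coeffGN, vec, h, h', Finsupp.single_apply]
  · have : g' ≠ g := fun e => h' (e ▸ h)
    simp [vec, h', this]

theorem single_eq_vec (n : ℕ) (g : {g : Gen // g.Valid n}) :
    Finsupp.single g (1 : ℂ) = vec n g.1 := by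
  simp [vec, g.2]

theorem coeffGN_table_of_degree_one (n : ℕ) (a b : ℂ) (v : ℕ → ℕ → Gen) (hv : v = .x ∨ v = .y)
    (hn : 5 ≤ n) (j : ℕ) (hj : j = 1 ∨ j = 2) (g g' : Gen) :
    coeffGN n (v 1 j) (table n a b g g') = 0 := by
  have hval : (v 1 j).Valid n := by
    rcases hv with rfl | rfl <;> simp only [Gen.Valid] <;> omega
  have key (g g' : Gen) : coeffGN n (v 1 j) (half n a b g g') = 0 := by
    rcases hv with rfl | rfl <;> cases g <;> cases g' <;> simp only [half] <;>
      (try split_ifs) <;>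
      simp only [map_zero, map_smul, coeffGN_vec _ _ _ hval, Gen.x.injEq, Gen.y.injEq, reduceCtorEq,
        if_false, smul_zero]
    all_goals first
      | exact if_neg (by omega)
      | (rw [if_neg (by omega)]; simp)
  simp [table, key]

namespace Params
variable (D : Params)

theorem ext_basis {V : Type*} [AddCommGroup V] [Module ℂ V] {f g : D.Alg →ₗ[ℂ] V}
    (h : ∀ i, f (D.basisVec i) = g (D.basisVec i)) : f = g := by
  refine Finsupp.lhom_ext' fun i => LinearMap.ext_ring ?_
  exact h i

theorem ext_basis₂ {V : Type*} [AddCommGroup V] [Module ℂ V] {f g : D.Alg →ₗ[ℂ] D.Alg →ₗ[ℂ] V}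
    (h : ∀ i j, f (D.basisVec i) (D.basisVec j) = g (D.basisVec i) (D.basisVec j)) : f = g :=
  D.ext_basis fun i => D.ext_basis fun j => h i j

/-- The inclusion of the copy `s` of `GN`. -/
noncomputable def copyIncl (s : Fin D.k) : GN D.n →ₗ[ℂ] D.Alg := inc D.n D.k s

/-- The inclusion of `sl₂`. -/
noncomputable def slIncl : (Sl →₀ ℂ) →ₗ[ℂ] D.Alg := incSl D.n D.k

theorem lie_sl_sl (r r' : Sl) :
    ⁅D.basisVec (.sl r), D.basisVec (.sl r')⁆ = D.slIncl (slTable r r') :=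
  bilin_single (lTable D.n D.k D.a D.b D.op) (.sl r) (.sl r')

theorem lie_sl_nil (r : Sl) (t : Fin D.k) (g : {g : Gen // g.Valid D.n}) :
    ⁅D.basisVec (.sl r), D.basisVec (.nil t g)⁆ = D.copyIncl t (act D.n r g.1) :=
  bilin_single (lTable D.n D.k D.a D.b D.op) (.sl r) (.nil t g)

theorem lie_nil_sl (r : Sl) (t : Fin D.k) (g : {g : Gen // g.Valid D.n}) :
    ⁅D.basisVec (.nil t g), D.basisVec (.sl r)⁆ = -D.copyIncl t (act D.n r g.1) :=
  bilin_single (lTable D.n D.k D.a D.b D.op) (.nil t g) (.sl r)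

theorem lie_nil_nil (s t : Fin D.k) (g g' : {g : Gen // g.Valid D.n}) :
    ⁅D.basisVec (.nil s g), D.basisVec (.nil t g')⁆ =
      D.copyIncl (ideal D.op s t)
        (table D.n (D.a (ideal D.op s t)) (D.b (ideal D.op s t)) g.1 g'.1) :=
  bilin_single (lTable D.n D.k D.a D.b D.op) (.nil s g) (.nil t g')

theorem psi_basisVec (i j : LIdx D.n D.k) :
    D.psi (D.basisVec i) (D.basisVec j) = D.psiTable i j :=
  bilin_single _ i j

/-- The basis vector with a given label in the copy `s` of `GN`; it is `0` if the label does not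
occur. -/
noncomputable def copyVec (s : Fin D.k) (g : Gen) : D.Alg := D.copyIncl s (vec D.n g)

theorem basisVec_nil (s : Fin D.k) (g : {g : Gen // g.Valid D.n}) :
    D.basisVec (.nil s g) = D.copyVec s g.1 := by
  rw [copyVec, ← single_eq_vec]
  exact (Finsupp.mapDomain_single (f := LIdx.nil s) (a := g) (b := (1 : ℂ))).symm

/-- The coordinates of an element in the copy `s` of `GN`. -/
noncomputable def copyProj (s : Fin D.k) : D.Alg →ₗ[ℂ] GN D.n :=
  Finsupp.lcomapDomain (LIdx.nil s) (fun _ _ e => by injection e)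

/-- The coordinate of a basis vector of `sl₂`. -/
noncomputable def slCoeff (r : Sl) : D.Alg →ₗ[ℂ] ℂ := Finsupp.lapply (LIdx.sl r)

open Classical in
theorem copyProj_copyIncl (s t : Fin D.k) (w : GN D.n) :
    D.copyProj s (D.copyIncl t w) = if t = s then w else 0 := by
  ext g
  by_cases h : t = s
  · subst h
    have : Function.Injective (LIdx.nil (n := D.n) t) := fun _ _ e => by injection e
    rw [if_pos rfl]
    exact Finsupp.mapDomain_apply this w g
  · rw [if_neg h]
    exact Finsupp.mapDomain_of_notMem_range _ _ (by rintro ⟨g', e⟩; injection e; contradiction)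

theorem copyProj_slIncl (s : Fin D.k) (x : Sl →₀ ℂ) : D.copyProj s (D.slIncl x) = 0 := by
  ext g
  exact Finsupp.mapDomain_of_notMem_range _ _ (by rintro ⟨g', e⟩; injection e)

open Classical in
theorem copyProj_copyVec (s t : Fin D.k) (g : Gen) :
    D.copyProj s (D.copyVec t g) = if t = s then vec D.n g else 0 := D.copyProj_copyIncl s t _

theorem copyProj_sl (s : Fin D.k) (r : Sl) : D.copyProj s (D.basisVec (.sl r)) = 0 := by
  have h : D.slIncl (Finsupp.single r 1) = D.basisVec (.sl r) := Finsupp.mapDomain_single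
  rw [← h, copyProj_slIncl]

open Classical in
theorem slCoeff_sl (r t : Sl) : D.slCoeff r (D.basisVec (.sl t)) = if t = r then 1 else 0 := by
  have : D.slCoeff r (D.basisVec (.sl t)) =
    (Finsupp.single (LIdx.sl t) (1 : ℂ) : LIdx D.n D.k →₀ ℂ) (LIdx.sl r) := rfl
  rw [this, Finsupp.single_apply]; simp

theorem slCoeff_nil (r : Sl) (s : Fin D.k) (g : {g : Gen // g.Valid D.n}) :
    D.slCoeff r (D.basisVec (.nil s g)) = 0 := by
  have : D.slCoeff r (D.basisVec (.nil s g)) =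
    (Finsupp.single (LIdx.nil s g) (1 : ℂ) : LIdx D.n D.k →₀ ℂ) (LIdx.sl r) := rfl
  rw [this, Finsupp.single_eq_of_ne (by simp)]

end Params

/-! ### Coordinates of degree one -/

theorem valid_degree_one (n : ℕ) (hn : 5 ≤ n) (v : ℕ → ℕ → Gen) (hv : v = .x ∨ v = .y) (j : ℕ)
    (hj : j = 1 ∨ j = 2) : (v 1 j).Valid n := by
  rcases hv with rfl | rfl <;> simp only [Gen.Valid] <;> omega

/-- The degree-one coordinates of the action of `sl₂`. -/
theorem coeffGN_act (n : ℕ) (hn : 5 ≤ n) (v : ℕ → ℕ → Gen) (hv : v = .x ∨ v = .y)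
    (g : Gen) (hg : g.Valid n) :
    coeffGN n (v 1 1) (act n .h g) = coeffGN n (v 1 1) (vec n g) ∧
    coeffGN n (v 1 1) (act n .e g) = coeffGN n (v 1 2) (vec n g) ∧
    coeffGN n (v 1 1) (act n .f g) = 0 ∧
    coeffGN n (v 1 2) (act n .h g) = - coeffGN n (v 1 2) (vec n g) ∧
    coeffGN n (v 1 2) (act n .e g) = 0 ∧
    coeffGN n (v 1 2) (act n .f g) = coeffGN n (v 1 1) (vec n g) := by
  have h1 := valid_degree_one n hn v hv 1 (.inl rfl)
  have h2 := valid_degree_one n hn v hv 2 (.inr rfl)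
  have key : g = v 1 1 ∨ g = v 1 2 ∨ (∀ r, coeffGN n (v 1 1) (act n r g) = 0 ∧
      coeffGN n (v 1 2) (act n r g) = 0) ∧ coeffGN n (v 1 1) (vec n g) = 0 ∧
        coeffGN n (v 1 2) (vec n g) = 0 := by
    rw [or_iff_not_imp_left, or_iff_not_imp_left]
    intro n1 n2
    refine ⟨fun r => ?_, ?_, ?_⟩
    · rcases hv with rfl | rfl <;> cases g <;> cases r <;>
        simp only [Gen.Valid, Gen.x.injEq, Gen.y.injEq, not_and] at n1 n2 hg <;>
        simp only [act, map_zero, map_smul, coeffGN_vec _ _ _ h1, coeffGN_vec _ _ _ h2,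
          Gen.x.injEq, Gen.y.injEq, reduceCtorEq, if_false, smul_zero, and_self]
      all_goals
        constructor <;> rw [if_neg (by omega), smul_zero]
    · rw [coeffGN_vec _ _ _ h1, if_neg n1]
    · rw [coeffGN_vec _ _ _ h2, if_neg n2]
  rcases key with rfl | rfl | ⟨h, h', h''⟩
  · rcases hv with rfl | rfl <;> simp [act, coeffGN_vec _ _ _ h1, coeffGN_vec _ _ _ h2]
  · rcases hv with rfl | rfl <;> simp [act, coeffGN_vec _ _ _ h1, coeffGN_vec _ _ _ h2] <;> norm_num
  · simp [h, h', h'']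

namespace Params
variable (D : Params)

/-- The index of the first copy of `GN`. -/
def first : Fin D.k := ⟨0, D.k_pos⟩

/-- The coordinate of a label in the first copy of `GN`. -/
noncomputable def coord (g : Gen) : D.Alg →ₗ[ℂ] ℂ := coeffGN D.n g ∘ₗ D.copyProj D.first

open Classical in
theorem coord_copyVec (s : Fin D.k) (g : Gen) (g' : Gen) :
    D.coord g (D.copyVec s g') = if s = D.first then coeffGN D.n g (vec D.n g') else 0 := by
  rw [coord, LinearMap.comp_apply, copyProj_copyVec]
  split_ifs <;> simp

open Classical in
theorem coord_nil (s : Fin D.k) (g : Gen) (g' : {g : Gen // g.Valid D.n}) :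
    D.coord g (D.basisVec (.nil s g')) =
      if s = D.first then coeffGN D.n g (vec D.n g'.1) else 0 := by
  rw [basisVec_nil, coord_copyVec]

theorem coord_sl (g : Gen) (r : Sl) : D.coord g (D.basisVec (.sl r)) = 0 := by
  simp [coord, copyProj_sl]

/-- The functionals `P`, `Q` are the coordinates of a `1`-cocycle with values in the standard
representation of `sl₂`, on which `D.Alg` acts through its `sl₂`-part: their values at `⁅u, v⁆` only
involve the `sl₂`-part of one argument and the values of `P` and `Q` at the other. -/
def IsStandardPair (P Q : D.Alg →ₗ[ℂ] ℂ) : Prop :=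
  ∀ u v : D.Alg,
    P ⁅u, v⁆ = D.slCoeff .h u * P v + D.slCoeff .e u * Q v -
      (D.slCoeff .h v * P u + D.slCoeff .e v * Q u) ∧
    Q ⁅u, v⁆ = D.slCoeff .f u * P v - D.slCoeff .h u * Q v -
      (D.slCoeff .f v * P u - D.slCoeff .h v * Q u)

/-- The vectors of degree one do not occur in products of `GN(a,b)`, so only `sl₂` contributes to
their coordinates in a bracket. -/
theorem isStandardPair_coord (v : ℕ → ℕ → Gen) (hv : v = .x ∨ v = .y) :
    D.IsStandardPair (D.coord (v 1 1)) (D.coord (v 1 2)) := by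
  classical
  have T (j : ℕ) (hj : j = 1 ∨ j = 2) (s : Fin D.k) (a b : ℂ) (g g' : Gen) :
      D.coord (v 1 j) (D.copyIncl s (table D.n a b g g')) = 0 := by
    rw [coord, LinearMap.comp_apply, copyProj_copyIncl]
    split_ifs
    · exact coeffGN_table_of_degree_one _ _ _ v hv D.five_le j hj g g'
    · simp
  have Z (g : Gen) (x : Sl →₀ ℂ) : D.coord g (D.slIncl x) = 0 := by
    simp [coord, copyProj_slIncl]
  have A (j : ℕ) (s : Fin D.k) (w : GN D.n) : D.coord (v 1 j) (D.copyIncl s w) =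
      if s = D.first then coeffGN D.n (v 1 j) w else 0 := by
    rw [coord, LinearMap.comp_apply, copyProj_copyIncl]
    split_ifs <;> simp
  let sm (p q : D.Alg →ₗ[ℂ] ℂ) : D.Alg →ₗ[ℂ] D.Alg →ₗ[ℂ] ℂ := (LinearMap.mul ℂ ℂ).compl₁₂ p q
  have e1 : D.br.compr₂ (D.coord (v 1 1)) =
      sm (D.slCoeff .h) (D.coord (v 1 1)) + sm (D.slCoeff .e) (D.coord (v 1 2)) -
      (sm (D.slCoeff .h) (D.coord (v 1 1)) + sm (D.slCoeff .e) (D.coord (v 1 2))).flip := by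
    refine D.ext_basis₂ fun i j => ?_
    simp only [sm, LinearMap.compr₂_apply, LinearMap.sub_apply, LinearMap.add_apply,
      LinearMap.flip_apply, LinearMap.compl₁₂_apply, LinearMap.mul_apply']
    rw [← lie_eq]
    rcases i with r | ⟨s, g, hg⟩ <;> rcases j with r' | ⟨t, g', hg'⟩
    · simp [lie_sl_sl, Z, coord_sl]
    · obtain ⟨a1, a2, a3, -⟩ := coeffGN_act D.n D.five_le v hv g' hg'
      cases r <;> simp [lie_sl_nil, A, coord_sl, slCoeff_sl, slCoeff_nil, coord_nil, a1, a2, a3]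
    · obtain ⟨a1, a2, a3, -⟩ := coeffGN_act D.n D.five_le v hv g hg
      cases r' <;> simp [lie_nil_sl, A, coord_sl, slCoeff_sl, slCoeff_nil, coord_nil, a1, a2, a3]
    · simp [lie_nil_nil, T 1 (.inl rfl), slCoeff_nil]
  have e2 : D.br.compr₂ (D.coord (v 1 2)) =
      sm (D.slCoeff .f) (D.coord (v 1 1)) - sm (D.slCoeff .h) (D.coord (v 1 2)) -
      (sm (D.slCoeff .f) (D.coord (v 1 1)) - sm (D.slCoeff .h) (D.coord (v 1 2))).flip := by
    refine D.ext_basis₂ fun i j => ?_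
    simp only [sm, LinearMap.compr₂_apply, LinearMap.sub_apply,
      LinearMap.flip_apply, LinearMap.compl₁₂_apply, LinearMap.mul_apply']
    rw [← lie_eq]
    rcases i with r | ⟨s, g, hg⟩ <;> rcases j with r' | ⟨t, g', hg'⟩
    · simp [lie_sl_sl, Z, coord_sl]
    · obtain ⟨-, -, -, a1, a2, a3⟩ := coeffGN_act D.n D.five_le v hv g' hg'
      cases r <;> simp [lie_sl_nil, A, coord_sl, slCoeff_sl, slCoeff_nil, coord_nil, a1, a2, a3]
      split_ifs <;> simp
    · obtain ⟨-, -, -, a1, a2, a3⟩ := coeffGN_act D.n D.five_le v hv g hg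
      cases r' <;> simp [lie_nil_sl, A, coord_sl, slCoeff_sl, slCoeff_nil, coord_nil, a1, a2, a3]
      split_ifs <;> simp
    · simp [lie_nil_nil, T 2 (.inr rfl), slCoeff_nil]
  exact fun u w => ⟨LinearMap.congr_fun₂ e1 u w, LinearMap.congr_fun₂ e2 u w⟩

/-! ### The cocycle condition -/

theorem lie_copyVec_c (s : Fin D.k) (u : D.Alg) : ⁅u, D.copyVec s .c⁆ = 0 := by
  have : D.br.flip (D.copyVec s .c) = 0 := by
    refine D.ext_basis fun i => ?_
    have h : D.copyVec s .c = D.basisVec (.nil s ⟨.c, trivial⟩) :=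
      (D.basisVec_nil s ⟨.c, trivial⟩).symm
    rw [LinearMap.flip_apply, ← lie_eq, h]
    rcases i with r | ⟨t, g, hg⟩
    · simp [lie_sl_nil, act]
    · rw [lie_nil_nil, table_skew, c_r]; simp
  exact LinearMap.congr_fun this u

/-- The cocycle in coordinates. -/
theorem psi_apply (u v : D.Alg) :
    D.psi u v = (D.coord (.x 1 1) u * D.coord (.y 1 2) v - D.coord (.x 1 2) u * D.coord (.y 1 1) v -
      (D.coord (.x 1 1) v * D.coord (.y 1 2) u - D.coord (.x 1 2) v * D.coord (.y 1 1) u)) •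
        D.copyVec D.first .c := by
  classical
  have X (j) (hj) :=
    coeffGN_vec D.n (.x 1 j) (h := valid_degree_one D.n D.five_le _ (.inl rfl) j hj)
  have Y (j) (hj) :=
    coeffGN_vec D.n (.y 1 j) (h := valid_degree_one D.n D.five_le _ (.inr rfl) j hj)
  let sm (p q : D.Alg →ₗ[ℂ] ℂ) : D.Alg →ₗ[ℂ] D.Alg →ₗ[ℂ] ℂ := (LinearMap.mul ℂ ℂ).compl₁₂ p q
  let B := sm (D.coord (.x 1 1)) (D.coord (.y 1 2)) - sm (D.coord (.x 1 2)) (D.coord (.y 1 1))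
  have H (g g' : Gen) : ((psiHalf g g' - psiHalf g' g) : ℂ) =
      coeffGN D.n (.x 1 1) (vec D.n g) * coeffGN D.n (.y 1 2) (vec D.n g') -
      coeffGN D.n (.x 1 2) (vec D.n g) * coeffGN D.n (.y 1 1) (vec D.n g') -
      (coeffGN D.n (.x 1 1) (vec D.n g') * coeffGN D.n (.y 1 2) (vec D.n g) -
      coeffGN D.n (.x 1 2) (vec D.n g') * coeffGN D.n (.y 1 1) (vec D.n g)) := by
    have key (g g' : Gen) : psiHalf g g' =
      coeffGN D.n (.x 1 1) (vec D.n g) * coeffGN D.n (.y 1 2) (vec D.n g') -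
      coeffGN D.n (.x 1 2) (vec D.n g) * coeffGN D.n (.y 1 1) (vec D.n g') := by
      rw [X 1 (.inl rfl), X 2 (.inr rfl), Y 1 (.inl rfl), Y 2 (.inr rfl)]
      unfold psiHalf
      split
      · simp
      · simp
      · rename_i h1 h2
        have a1 : ¬ (g = .x 1 1 ∧ g' = .y 1 2) := fun e => h1 e.1 e.2
        have a2 : ¬ (g = .x 1 2 ∧ g' = .y 1 1) := fun e => h2 e.1 e.2
        simp only [← ite_and, mul_ite, mul_one, mul_zero]
        rw [if_neg (fun e => a1 ⟨e.2, e.1⟩), if_neg (fun e => a2 ⟨e.2, e.1⟩), sub_zero]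
    rw [key, key]
  have e : D.psi.1 =
      (B - B.flip).compr₂ (LinearMap.toSpanSingleton ℂ _ (D.copyVec D.first .c)) := by
    refine D.ext_basis₂ fun i j => ?_
    refine (D.psi_basisVec i j).trans ?_
    simp only [B, sm, LinearMap.compr₂_apply, LinearMap.sub_apply, LinearMap.flip_apply,
      LinearMap.compl₁₂_apply, LinearMap.mul_apply', LinearMap.toSpanSingleton_apply]
    rcases i with r | ⟨s, g, hg⟩ <;> rcases j with r' | ⟨t, g', hg'⟩
    · simp [psiTable, coord_sl]
    · simp [psiTable, coord_sl]
    · simp [psiTable, coord_sl]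
    · have F (s : Fin D.k) : s = D.first ↔ s.val = 0 := by simp [first, Fin.ext_iff]
      simp only [psiTable, basisVec_nil, coord_copyVec, F]
      by_cases hs : s.val = 0
      · by_cases ht : t.val = 0
        · rw [(F s).2 hs, (F t).2 ht]
          simp only [H g g']
          simp [first]
        · simp [ht]
      · simp [hs]
  exact LinearMap.congr_fun₂ e u v

theorem psi_copyVec_c (s : Fin D.k) (u : D.Alg) : D.psi (D.copyVec s .c) u = 0 := by
  classical
  rw [psi_apply]
  have X (j) (hj) :=
    coeffGN_vec D.n (.x 1 j) (h := valid_degree_one D.n D.five_le _ (.inl rfl) j hj)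
  have Y (j) (hj) :=
    coeffGN_vec D.n (.y 1 j) (h := valid_degree_one D.n D.five_le _ (.inr rfl) j hj)
  simp [coord_copyVec, X 1 (.inl rfl), X 2 (.inr rfl), Y 1 (.inl rfl), Y 2 (.inr rfl)]

theorem psi_psi (u v w : D.Alg) : D.psi (D.psi u v) w = 0 := by
  rw [psi_apply D u v, map_smul, LinearMap.smul_apply, psi_copyVec_c, smul_zero]

theorem lie_psi (u v w : D.Alg) : ⁅u, D.psi v w⁆ = 0 := by
  rw [psi_apply, lie_smul, lie_copyVec_c, smul_zero]

theorem psi_lie (u v w : D.Alg) : ⁅D.psi u v, w⁆ = 0 := by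
  rw [← lie_skew, lie_psi, neg_zero]

theorem psi_sl_invariant (s : Sl) (u v : D.Alg) :
    D.psi ⁅D.basisVec (.sl s), u⁆ v + D.psi u ⁅D.basisVec (.sl s), v⁆ = 0 := by
  have hx := D.isStandardPair_coord .x (.inl rfl)
  have hy := D.isStandardPair_coord .y (.inr rfl)
  simp only [psi_apply, ← add_smul, hx _ _, hy _ _, coord_sl]
  rw [← zero_smul ℂ (D.copyVec D.first .c)]
  congr 1
  ring

theorem psi_lie_cyclic (u v w : D.Alg) :
    D.psi ⁅u, v⁆ w + D.psi ⁅v, w⁆ u + D.psi ⁅w, u⁆ v = 0 := by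
  have hx := D.isStandardPair_coord .x (.inl rfl)
  have hy := D.isStandardPair_coord .y (.inr rfl)
  simp only [psi_apply, ← add_smul, hx _ _, hy _ _]
  rw [← zero_smul ℂ (D.copyVec D.first .c)]
  congr 1
  ring

theorem psi_mem_twoCocycle : D.psi ∈ LieModule.Cohomology.twoCocycle ℂ D.Alg D.Alg := by
  rw [LieModule.Cohomology.mem_twoCocycle_iff]
  ext u v w : 3
  have h := D.psi_lie_cyclic u v w
  simp only [LieModule.Cohomology.d₂₃_apply, lie_psi, LinearMap.zero_apply]
  rw [← lie_skew w u, map_neg, LinearMap.neg_apply] at h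
  refine Eq.trans ?_ ((congrArg Neg.neg h).trans neg_zero)
  abel

end Params

/-! ### Coordinates of products in `GN(a,b)` -/

/-- In the bracket of `g₀` with a vector of `GN(a,b)`, the coordinate at `g` is `r` times the
coordinate of the vector at `g₁`. The first condition says that `sl₂` does not move `g₀` to `g`, so
that the `sl₂`-part of an element of the whole algebra does not contribute to this coordinate. -/
def TableCoeff (n : ℕ) (a b : ℂ) (g₀ g g₁ : Gen) (r : ℂ) : Prop :=
  (∀ t, coeffGN n g (act n t g₀) = 0) ∧
  ∀ g', g'.Valid n → coeffGN n g (table n a b g₀ g') = r * coeffGN n g₁ (vec n g')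

theorem tableCoeff_c (n : ℕ) (hn : 5 ≤ n) (a b : ℂ) :
    TableCoeff n a b (.x 1 1) .c (.x 1 2) 1 ∧ TableCoeff n a b (.x 1 2) .c (.x 1 1) (-1) ∧
    TableCoeff n a b (.y 1 1) .c (.y 1 2) 1 ∧ TableCoeff n a b (.y 1 2) .c (.y 1 1) (-1) := by
  have hc : Gen.Valid n .c := trivial
  have x1 := valid_degree_one n hn _ (.inl rfl) 1 (.inl rfl)
  have x2 := valid_degree_one n hn _ (.inl rfl) 2 (.inr rfl)
  have y1 := valid_degree_one n hn _ (.inr rfl) 1 (.inl rfl)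
  have y2 := valid_degree_one n hn _ (.inr rfl) 2 (.inr rfl)
  refine ⟨?_, ?_, ?_, ?_⟩ <;>
    refine ⟨fun t => by cases t <;> simp [act, coeffGN_vec _ _ _ hc], fun g' h => ?_⟩ <;>
    cases g' <;>
    simp only [table, half, map_sub, apply_ite (coeffGN n .c), map_smul, coeffGN_vec _ _ _ hc,
      coeffGN_vec _ _ _ x1, coeffGN_vec _ _ _ x2, coeffGN_vec _ _ _ y1, coeffGN_vec _ _ _ y2,
      map_zero, smul_zero, reduceCtorEq, if_false, ite_self, if_true, Gen.x.injEq, Gen.y.injEq]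
  all_goals grind

theorem tableCoeff_x4 (n : ℕ) (hn : 5 ≤ n) (a b : ℂ) (j l : ℕ) (hj : j = 1 ∨ j = 2) :
    TableCoeff n a b (.y 1 l) (.x 4 j) .c 0 ∧
    TableCoeff n a b (.x 3 1) (.x 4 j) (.x 1 j) (-1) := by
  have h4 : Gen.Valid n (.x 4 j) := by simp only [Gen.Valid]; omega
  have x1 := valid_degree_one n hn _ (.inl rfl) j hj
  have hc : Gen.Valid n .c := trivial
  refine ⟨?_, ?_⟩ <;>
    refine ⟨fun t => by cases t <;> simp [act, coeffGN_vec _ _ _ h4], fun g' h => ?_⟩ <;>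
    cases g' <;>
    simp only [table, half, map_sub, apply_ite (coeffGN n (.x 4 j)), map_smul,
      coeffGN_vec _ _ _ h4, coeffGN_vec _ _ _ hc,
      coeffGN_vec _ _ _ x1,
      map_zero, smul_zero, reduceCtorEq, if_false, ite_self, if_true, Gen.x.injEq]
  all_goals simp only [Gen.Valid] at h
  all_goals grind

theorem tableCoeff_y4 (n : ℕ) (hn : 5 ≤ n) (a b : ℂ) (i j : ℕ) (hj : j = 1 ∨ j = 2)
    (hi : i = 1 ∨ i = 4) :
    TableCoeff n a b (.y 3 i) (.y 4 (i + j - 1)) (.y 1 j) (-1) := by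
  have h4 : Gen.Valid n (.y 4 (i + j - 1)) := by simp only [Gen.Valid]; omega
  have y1 := valid_degree_one n hn _ (.inr rfl) j hj
  refine ⟨fun t => by cases t <;> simp [act, coeffGN_vec _ _ _ h4], fun g' h => ?_⟩
  cases g' <;>
    simp only [table, half, map_sub, apply_ite (coeffGN n (.y 4 _)), map_smul,
      coeffGN_vec _ _ _ h4, coeffGN_vec _ _ _ y1,
      map_zero, reduceCtorEq, if_false, ite_self, Gen.y.injEq]
  all_goals simp only [Gen.Valid] at h
  all_goals grind

/-- For `n = 5` the degree `4` is the degree `n - 1`, so that `[x_j, y_{i+1}^n]` has a component in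
`y^4`; otherwise no bracket with `x_j` has one. -/
theorem tableCoeff_y4_of_x (n : ℕ) (hn : 5 ≤ n) (a b : ℂ) (i j : ℕ) (hj : j = 1 ∨ j = 2)
    (hi : i = 1 ∨ i = 4) :
    TableCoeff n a b (.x 1 j) (.y 4 (i + j - 1)) (.y n (i + 1))
      (if n = 5 then a * (i - (j - 1) * 5) else 0) := by
  have h4 : Gen.Valid n (.y 4 (i + j - 1)) := by simp only [Gen.Valid]; omega
  have y1 : Gen.Valid n (.y n (i + 1)) := by simp only [Gen.Valid]; omega
  refine ⟨fun t => by cases t <;> simp [act, coeffGN_vec _ _ _ h4], fun g' h => ?_⟩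
  cases g' <;>
    simp only [table, half, map_sub, apply_ite (coeffGN n (.y 4 _)), map_smul,
      coeffGN_vec _ _ _ h4, coeffGN_vec _ _ _ y1,
      map_zero, reduceCtorEq, if_false, ite_self, Gen.y.injEq, mul_zero, sub_zero]
  all_goals simp only [Gen.Valid] at h
  all_goals
    rename_i p q
    have k1 : n = 5 → (n : ℂ) = 5 := by rintro rfl; norm_num
    have k2 : q = 2 → (q : ℂ) = 2 := by rintro rfl; norm_num
    have k3 : q = 5 → (q : ℂ) = 5 := by rintro rfl; norm_num
    try simp only [smul_eq_mul]
    rcases hj with rfl | rfl <;> rcases hi with rfl | rfl <;> push_cast <;> grind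

/-! ### Finiteness of the basis -/

theorem finite_valid (n : ℕ) : Finite {g : Gen // g.Valid n} := by
  let A := Option (Bool × Fin (n + 1) × Fin (n + 2))
  let F : A → Gen := fun t => match t with
    | none => .c
    | some (true, p, i) => .x p i
    | some (false, p, i) => .y p i
  refine Set.Finite.subset (Set.finite_range F) ?_
  rintro (_ | ⟨p, i⟩ | ⟨p, i⟩) h
  · exact ⟨none, rfl⟩
  · obtain ⟨h1, h2, h3, h4⟩ := h
    exact ⟨some (true, ⟨p, by omega⟩, ⟨i, by omega⟩), rfl⟩
  · obtain ⟨h1, h2, h3, h4, h5⟩ := h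
    exact ⟨some (false, ⟨p, by omega⟩, ⟨i, by omega⟩), rfl⟩

theorem finite_LIdx (n k : ℕ) : Finite (LIdx n k) := by
  have := finite_valid n
  let F : Fin 3 ⊕ Fin k × {g : Gen // g.Valid n} → LIdx n k := fun t => match t with
    | .inl 0 => .sl .e
    | .inl 1 => .sl .h
    | .inl 2 => .sl .f
    | .inr (s, g) => .nil s g
  refine Finite.of_surjective F ?_
  rintro (r | ⟨s, g⟩)
  · cases r
    · exact ⟨.inl 0, rfl⟩
    · exact ⟨.inl 1, rfl⟩
    · exact ⟨.inl 2, rfl⟩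
  · exact ⟨.inr (s, g), rfl⟩

namespace Params
variable (D : Params)

/-! ### Brackets with the first copy -/

open Classical in
/-- The sum of the coordinates of a label over all copies whose brackets with the first copy lie
in the first copy. -/
noncomputable def pooledCoord (g : Gen) : D.Alg →ₗ[ℂ] ℂ :=
  ∑ t with ideal D.op D.first t = D.first, coeffGN D.n g ∘ₗ D.copyProj t

theorem pooledCoord_sl (g : Gen) (r : Sl) : D.pooledCoord g (D.basisVec (.sl r)) = 0 := by
  simp [pooledCoord, copyProj_sl]

open Classical in
theorem pooledCoord_copyVec (s : Fin D.k) (g g' : Gen) : D.pooledCoord g (D.copyVec s g') =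
    if ideal D.op D.first s = D.first then coeffGN D.n g (vec D.n g') else 0 := by
  rw [pooledCoord, LinearMap.sum_apply, Finset.sum_filter]
  simp only [LinearMap.comp_apply, copyProj_copyVec, apply_ite (coeffGN D.n g), map_zero, ← ite_and]
  rw [Finset.sum_eq_single s (fun t _ ht => if_neg (fun e => ht e.2.symm)) (by simp)]
  simp

theorem coord_lie {g₀ g g₁ : Gen} {r : ℂ} (h₀ : g₀.Valid D.n)
    (h : TableCoeff D.n (D.a D.first) (D.b D.first) g₀ g g₁ r) (v : D.Alg) :
    D.coord g ⁅D.copyVec D.first g₀, v⁆ = r * D.pooledCoord g₁ v := by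
  classical
  have A (s : Fin D.k) (w : GN D.n) : D.coord g (D.copyIncl s w) =
      if s = D.first then coeffGN D.n g w else 0 := by
    rw [coord, LinearMap.comp_apply, copyProj_copyIncl]
    split_ifs <;> simp
  have : D.coord g ∘ₗ D.br (D.copyVec D.first g₀) = r • D.pooledCoord g₁ := by
    refine D.ext_basis fun i => ?_
    rw [LinearMap.comp_apply, ← lie_eq, ← D.basisVec_nil D.first ⟨g₀, h₀⟩, LinearMap.smul_apply]
    rcases i with t | ⟨s, g', hg'⟩
    · simp [lie_nil_sl, A, h.1, pooledCoord_sl]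
    · rw [lie_nil_nil, basisVec_nil, pooledCoord_copyVec, A]
      split_ifs with hs
      · rw [hs, h.2 g' hg', smul_eq_mul]
      · simp
  exact LinearMap.congr_fun this v

theorem lie_copyVec_first {g g' : Gen} (h : g.Valid D.n) (h' : g'.Valid D.n) :
    ⁅D.copyVec D.first g, D.copyVec D.first g'⁆ =
      D.copyIncl D.first (table D.n (D.a D.first) (D.b D.first) g g') := by
  have hs : ideal D.op D.first D.first = D.first := by
    simp only [ideal]; split_ifs <;> cases D.op D.first <;> rfl
  rw [← D.basisVec_nil D.first ⟨g, h⟩, ← D.basisVec_nil D.first ⟨g', h'⟩, lie_nil_nil, hs]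

/-! ### The cocycle is not a coboundary -/

/-- If `Ψ = dφ`, the `c`-coordinates of this equation at `(x₁, y₂)` and `(x₂, y₁)` say that the
trace of the map sending `x_j` to the `y_j`-part of `φ x_j` plus that of the map sending `y_j` to
the `x_j`-part of `φ y_j` is `2`; the equations at `(y_j, x_1^3)` and `(x_j, y_i^3)` make both
traces vanish. -/
theorem psi_notMem_range : D.psi ∉ LinearMap.range (LieModule.Cohomology.d₁₂ ℂ D.Alg D.Alg) := by
  classical
  rintro ⟨φ, hφ⟩
  have E (u v : D.Alg) : D.psi u v = ⁅u, φ v⁆ - ⁅v, φ u⁆ - φ ⁅u, v⁆ := by rw [← hφ]; rfl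
  have hn := D.five_le
  have vx (j : ℕ) (hj : j = 1 ∨ j = 2) := valid_degree_one D.n hn _ (.inl rfl) j hj
  have vy (j : ℕ) (hj : j = 1 ∨ j = 2) := valid_degree_one D.n hn _ (.inr rfl) j hj
  have vx3 : Gen.Valid D.n (.x 3 1) := by simp only [Gen.Valid]; omega
  have vy3 (i : ℕ) (hi : i = 1 ∨ i = 4) : Gen.Valid D.n (.y 3 i) := by
    simp only [Gen.Valid]; omega
  have vc : Gen.Valid D.n .c := trivial
  have P (g g' : Gen) : D.psi (D.copyVec D.first g) (D.copyVec D.first g') =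
      ((coeffGN D.n (.x 1 1) (vec D.n g) * coeffGN D.n (.y 1 2) (vec D.n g') -
      coeffGN D.n (.x 1 2) (vec D.n g) * coeffGN D.n (.y 1 1) (vec D.n g') -
      (coeffGN D.n (.x 1 1) (vec D.n g') * coeffGN D.n (.y 1 2) (vec D.n g) -
      coeffGN D.n (.x 1 2) (vec D.n g') * coeffGN D.n (.y 1 1) (vec D.n g)))) •
        D.copyVec D.first .c := by
    rw [psi_apply]; simp only [coord_copyVec, if_true]
  simp only [coeffGN_vec _ _ _ (vx 1 (.inl rfl)), coeffGN_vec _ _ _ (vx 2 (.inr rfl)),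
    coeffGN_vec _ _ _ (vy 1 (.inl rfl)), coeffGN_vec _ _ _ (vy 2 (.inr rfl))] at P
  have C1 : D.coord .c (D.copyVec D.first .c) = 1 := by
    simp [coord_copyVec, coeffGN_vec _ _ _ vc]
  obtain ⟨c1, c2, c3, c4⟩ := tableCoeff_c D.n hn (D.a D.first) (D.b D.first)
  -- The `c`-coordinates of the coboundary equation at `(x₁, y₂)` and `(x₂, y₁)`, where the two
  -- brackets agree.
  have hxy : ⁅D.copyVec D.first (.x 1 1), D.copyVec D.first (.y 1 2)⁆ =
      ⁅D.copyVec D.first (.x 1 2), D.copyVec D.first (.y 1 1)⁆ := by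
    rw [D.lie_copyVec_first (vx 1 (.inl rfl)) (vy 2 (.inr rfl)),
      D.lie_copyVec_first (vx 2 (.inr rfl)) (vy 1 (.inl rfl))]
    have h1 : 1 ≠ D.n := by omega
    have h2 : 2 ≠ D.n := by omega
    simp [table, half, h1, h2]
  have e1 := congrArg (D.coord .c) (E (D.copyVec D.first (.x 1 1)) (D.copyVec D.first (.y 1 2)))
  have e2 := congrArg (D.coord .c) (E (D.copyVec D.first (.x 1 2)) (D.copyVec D.first (.y 1 1)))
  rw [← hxy] at e2
  simp only [P, map_sub, map_smul, C1, D.coord_lie (vx 1 (.inl rfl)) c1,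
    D.coord_lie (vx 2 (.inr rfl)) c2, D.coord_lie (vy 1 (.inl rfl)) c3,
    D.coord_lie (vy 2 (.inr rfl)) c4] at e1 e2
  simp at e1 e2
  -- In the equation at `(y_j, x_1^3)` only `[x_1^3, φ y_j]` has a component in `x^4`.
  have ex (j : ℕ) (hj : j = 1 ∨ j = 2) :
      D.pooledCoord (.x 1 j) (φ (D.copyVec D.first (.y 1 j))) = 0 := by
    obtain ⟨t1, t2⟩ := tableCoeff_x4 D.n hn (D.a D.first) (D.b D.first) j j hj
    have h := congrArg (D.coord (.x 4 j))
      (E (D.copyVec D.first (.y 1 j)) (D.copyVec D.first (.x 3 1)))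
    have h0 : table D.n (D.a D.first) (D.b D.first) (.y 1 j) (.x 3 1) = 0 := by
      have h1 : 3 + 1 ≠ D.n := by omega
      have h2 : 3 ≠ D.n := by omega
      simp [table, half, h1, h2]
    rw [P, D.lie_copyVec_first (vy j hj) vx3, h0] at h
    simp only [map_sub, map_smul, D.coord_lie (vy j hj) t1, D.coord_lie vx3 t2] at h
    simpa using h.symm
  -- In the equation at `(x_j, y_i^3)` the component in `y^4` comes from `[y_i^3, φ x_j]`, and for
  -- `n = 5` also from `[x_j, φ y_i^3]`.
  have ey (i j : ℕ) (hi : i = 1 ∨ i = 4) (hj : j = 1 ∨ j = 2) :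
      (if D.n = 5 then D.a D.first * (i - (j - 1) * 5) else 0) *
        D.pooledCoord (.y D.n (i + 1)) (φ (D.copyVec D.first (.y 3 i))) +
      D.pooledCoord (.y 1 j) (φ (D.copyVec D.first (.x 1 j))) = 0 := by
    have t1 := tableCoeff_y4_of_x D.n hn (D.a D.first) (D.b D.first) i j hj hi
    have t2 := tableCoeff_y4 D.n hn (D.a D.first) (D.b D.first) i j hj hi
    have h := congrArg (D.coord (.y 4 (i + j - 1)))
      (E (D.copyVec D.first (.x 1 j)) (D.copyVec D.first (.y 3 i)))
    have h0 : table D.n (D.a D.first) (D.b D.first) (.x 1 j) (.y 3 i) = 0 := by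
      have h2 : 3 ≠ D.n := by omega
      simp [table, half, h2]
    rw [P, D.lie_copyVec_first (vx j hj) (vy3 i hi), h0] at h
    simp only [map_sub, map_smul, D.coord_lie (vx j hj) t1, D.coord_lie (vy3 i hi) t2] at h
    simpa using h.symm
  have x1 := ex 1 (.inl rfl)
  have x2 := ex 2 (.inr rfl)
  have y11 := ey 1 1 (.inl rfl) (.inl rfl)
  have y12 := ey 1 2 (.inl rfl) (.inr rfl)
  have y41 := ey 4 1 (.inr rfl) (.inl rfl)
  have y42 := ey 4 2 (.inr rfl) (.inr rfl)
  push_cast at y11 y12 y41 y42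
  have y0 : D.pooledCoord (.y 1 1) (φ (D.copyVec D.first (.x 1 1))) +
      D.pooledCoord (.y 1 2) (φ (D.copyVec D.first (.x 1 2))) = 0 := by
    -- For `n = 5` and `j = 1, 2` the coefficients of the `y^n`-terms are `a, -4a` at `i = 1`, and
    -- `4a, -a` at `i = 4`; the combination eliminates both unknown coordinates.
    split_ifs at y11 y12 y41 y42
    · linear_combination (4 / 5 : ℂ) * y11 + (1 / 5) * y12 + (1 / 5) * y41 + (4 / 5) * y42
    · linear_combination y11 + y12
  have : (2 : ℂ) = 0 := by
    linear_combination e1 - e2 + x1 + x2 + y0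
  exact two_ne_zero this

/-! ### A nontrivial deformation -/

/-- The bracket of the algebra as a cochain. -/
noncomputable def brCochain : LieModule.Cohomology.twoCochain ℂ D.Alg D.Alg :=
  ⟨D.br, fun u => lie_self u⟩

theorem brCochain_apply (u v : D.Alg) : D.brCochain u v = ⁅u, v⁆ := rfl

/-- The coefficients of powers of `t` in the deformation `[,] + t Ψ`. -/
noncomputable def deformation : ℕ → LieModule.Cohomology.twoCochain ℂ D.Alg D.Alg
  | 0 => D.brCochain
  | 1 => D.psi
  | _ => 0

/-- The coefficient of `t` in the Jacobi identity is the cocycle identity, and that of `t²` holds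
as `Ψ(Ψ(u, v), w) = 0`. -/
theorem isFormalDeformation_deformation : IsFormalDeformation D.Alg D.deformation := by
  refine ⟨fun _ _ => rfl, fun m u v w => ?_⟩
  have z (f : D.Alg) (g : D.Alg) :
      (0 : LieModule.Cohomology.twoCochain ℂ D.Alg D.Alg) f g = 0 := rfl
  match m with
  | 0 =>
    rw [Finset.Nat.sum_antidiagonal_eq_sum_range_succ_mk, Finset.sum_range_one]
    simp only [deformation, brCochain_apply]
    have h := D.br_jac w u v
    simp only [← lie_eq] at h
    rw [← lie_skew ⁅u, v⁆ w, ← lie_skew ⁅v, w⁆ u, ← lie_skew ⁅w, u⁆ v, ← neg_add, ← neg_add, h,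
      neg_zero]
  | 1 =>
    rw [Finset.Nat.sum_antidiagonal_eq_sum_range_succ_mk, Finset.sum_range_succ,
      Finset.sum_range_one]
    simp only [deformation, brCochain_apply, Nat.sub_zero, Nat.sub_self]
    rw [D.psi_lie_cyclic]
    simp only [psi_lie, add_zero]
  | m + 2 =>
    refine Finset.sum_eq_zero fun p hp => ?_
    have h : p.1 + p.2 = m + 2 := Finset.HasAntidiagonal.mem_antidiagonal.1 hp
    obtain ⟨i, j⟩ := p
    match i, j with
    | 0, j + 2 => simp [deformation, z]
    | 1, 1 => simp [deformation, psi_psi]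
    | 1, j + 2 => simp [deformation, z]
    | i + 2, j => simp [deformation, z]

/-- A trivialization of the deformation would exhibit its first-order term as a coboundary. -/
theorem not_rigid : ¬ Rigid D.Alg := by
  intro h
  obtain ⟨φ, h0, h1⟩ := h _ D.isFormalDeformation_deformation
  refine D.psi_notMem_range ⟨φ 1, ?_⟩
  refine Subtype.ext (LinearMap.ext₂ fun u v => ?_)
  have h := h1 1 u v
  simp only [Finset.Nat.sum_antidiagonal_eq_sum_range_succ_mk, Finset.sum_range_succ,
      Finset.sum_range_zero, deformation, brCochain_apply, Nat.sub_zero, Nat.sub_self, h0,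
      LinearMap.id_apply, zero_add] at h
  change ⁅u, φ 1 v⁆ - ⁅v, φ 1 u⁆ - φ 1 ⁅u, v⁆ = D.psi u v
  rw [← lie_skew v, sub_neg_eq_add, ← h]
  abel

/-! ### The second cohomology -/

theorem one_le_finrank_H2 : 1 ≤ Module.finrank ℂ (H2 ℂ D.Alg D.Alg) := by
  have := finite_LIdx D.n D.k
  have : Module.Finite ℂ D.Alg := inferInstanceAs (Module.Finite ℂ (LIdx D.n D.k →₀ ℂ))
  have : Module.Finite ℂ (LieModule.Cohomology.twoCochain ℂ D.Alg D.Alg) := inferInstance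
  have : Module.Finite ℂ (LieModule.Cohomology.twoCocycle ℂ D.Alg D.Alg) := inferInstance
  have : Module.Finite ℂ (H2 ℂ D.Alg D.Alg) := inferInstance
  have : Nontrivial (H2 ℂ D.Alg D.Alg) := by
    refine ⟨Submodule.Quotient.mk ⟨D.psi, D.psi_mem_twoCocycle⟩, 0, fun h => ?_⟩
    rw [Submodule.Quotient.mk_eq_zero] at h
    exact D.psi_notMem_range h
  exact Module.finrank_pos

end Params

end Sato

theorem theorem3p4 (D : Sato.Params) :
    1 ≤ Module.finrank ℂ (Sato.H2 ℂ D.Alg D.Alg) ∧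
    (∀ (s : Sato.Sl) (u v : D.Alg),
      ⁅D.basisVec (.sl s), D.psi u v⁆ =
        D.psi ⁅D.basisVec (.sl s), u⁆ v + D.psi u ⁅D.basisVec (.sl s), v⁆) ∧
    D.psi ∈ LieModule.Cohomology.twoCocycle ℂ D.Alg D.Alg ∧
    D.psi ∉ LinearMap.range (LieModule.Cohomology.d₁₂ ℂ D.Alg D.Alg) ∧
    ¬ Sato.Rigid D.Alg := by
  refine ⟨D.one_le_finrank_H2, fun s u v => ?_, D.psi_mem_twoCocycle, D.psi_notMem_range,
    D.not_rigid⟩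
  rw [D.lie_psi, D.psi_sl_invariant]
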